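/- **Programs.** Let $\mathsf{Var}$ be a countably infinite set of variables (identified with $\mathbb N$). Arithmetical expressions $e$ are built from variables and constants in $\mathbb Q_{\ge 0}$ by $+,-,\cdot$; Boolean expressions $b$ are built from comparisons $e_1=e_2$, $e_1<e_2$ by negation and conjunction. The set $\mathsf{Prog}$ of fully probabilistic programs is given by the grammar $$P ::= v := e \;\mid\; P;P \;\mid\; \{P\}\,[p]\,\{P\} \;\mid\; \mathtt{WHILE}\,(b)\,\{P\},\qquad v\in\mathsf{Var},\ p\in[0,1]\cap\mathbb Q .$$ A valuation is a map $\eta:\mathsf{Var}\to\mathbb Q_{\ge 0}$; expressions are evaluated in $\mathbb Q$, giving $[\![e]\!]_\eta$ and $[\![b]\!]_\eta$. **Semantics.** A state is a tuple $\langle C,\eta,a,\theta\rangle$, where the control $C$ is the terminated program $\downarrow$, a program, or a residual $C';Q$ of a started concatenation, $\eta$ is a valuation, $a\in\mathbb Q_{\ge 0}$ is the probability of the choices made so far, and $\theta\in\{L,R\}^*$ is the sequence of these choices. The relation $\vdash$ is the smallest one with - $\langle v:=e,\eta,a,\theta\rangle\vdash\langle\downarrow,\eta[v\mapsto\max\{[\![e]\!]_\eta,0\}],a,\theta\rangle$;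 - $\langle C;Q,\eta,a,\theta\rangle\vdash\langle C';Q,\eta',a',\theta'\rangle$ whenever $\langle C,\eta,a,\theta\rangle\vdash\langle C',\eta',a',\theta'\rangle$; - $\langle \downarrow;Q,\eta,a,\theta\rangle\vdash\langle Q,\eta,a,\theta\rangle$; - $\langle\{P\}[p]\{Q\},\eta,a,\theta\rangle\vdash\langle P,\eta,a\cdot p,\theta L\rangle$ and $\langle\{P\}[p]\{Q\},\eta,a,\theta\rangle\vdash\langle Q,\eta,a\cdot(1-p),\theta R\rangle$; - $\langle\mathtt{WHILE}(b)\{P\},\eta,a,\theta\rangle\vdash\langle P;\mathtt{WHILE}(b)\{P\},\eta,a,\theta\rangle$ if $[\![b]\!]_\eta$ is true, and $\vdash\langle\downarrow,\eta,a,\theta\rangle$ if it is false. For a state $\sigma$, $k\in\mathbb N$ and $w\in\{L,R\}^*$ let $T_k(\sigma,w)$ be the unique state reached from $\sigma$ in exactly $k$ steps during which exactly the choices $w$ are made, in this order, and $\bot$ if there is no such state. Let $\alpha(\langle\downarrow,\eta,a,\theta\rangle)=a$ and $\alpha=0$ on all other states and on $\bot$. The probability that $P$ terminates on $\eta$ is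 $$\Pr_{P,\eta}(\downarrow)=\sum_{k=0}^{\infty}\ \sum_{w\in\{L,R\}^{\le k}}\alpha\big(T_k(\langle P,\eta,1,\varepsilon\rangle,w)\big).$$ **The problem.** An input is a valuation $\eta$ with $\eta(v)\neq 0$ for only finitely many $v$. Let $\mathcal{AST}$ be the set of all pairs $(P,\eta)$ of a program $P\in\mathsf{Prog}$ and an input $\eta$ with $\Pr_{P,\eta}(\downarrow)=1$. Programs and inputs are coded effectively by natural numbers in the usual way. A set $A$ of effectively coded objects is in $\Pi^0_2$ if there is a decidable relation $R$ with $A=\{x\mid \forall y_1\in\mathbb N\ \exists y_2\in\mathbb N:\ (x,y_1,y_2)\in R\}$. It is $\Pi^0_2$-complete if it is in $\Pi^0_2$ and every $C\in\Pi^0_2$ is many-one reducible to it, i.e. there is a computable function $f$ with $x\in C\Leftrightarrow f(x)\in A$ for all $x$. **Theorem.** $\mathcal{AST}$ is $\Pi^0_2$-complete. -/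

import Mathlib

open scoped NNRat NNReal ENNReal

/-! ## Second level of the arithmetical hierarchy -/

/-- `A` is a `Π₂⁰` set: `A = {x | ∀ y₁, ∃ y₂, R (x, y₁, y₂)}` for a decidable relation `R`. -/
def IsPi2 {α : Type} [Primcodable α] (A : Set α) : Prop :=
  ∃ R : α × ℕ × ℕ → Prop, ComputablePred R ∧ ∀ x, x ∈ A ↔ ∀ y₁, ∃ y₂, R (x, y₁, y₂)

/-- `A` is `Π₂⁰`-complete: it is `Π₂⁰`, and every `Π₂⁰` set (over any effectively coded universe)
is many-one reducible to it. -/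
structure IsPi2Complete {α : Type} [Primcodable α] (A : Set α) : Prop where
  mem : IsPi2 A
  hard : ∀ (β : Type) [Primcodable β] (C : Set β), IsPi2 C → (· ∈ C) ≤₀ (· ∈ A)

namespace PGCL

/-! ## Syntax -/

/-- Program variables. -/
abbrev Var := ℕ

/-- Variable valuations. -/
abbrev Valuation := Var → ℚ≥0

/-- Arithmetical expressions. -/
inductive AExp
  | const (q : ℚ≥0)
  | var (v : Var)
  | add (e₁ e₂ : AExp)
  | sub (e₁ e₂ : AExp)
  | mul (e₁ e₂ : AExp)

/-- Boolean expressions over arithmetical expressions. -/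
inductive BExp
  | eq (e₁ e₂ : AExp)
  | lt (e₁ e₂ : AExp)
  | not (b : BExp)
  | and (b₁ b₂ : BExp)

/-- Rational probabilities. -/
abbrev Prob := {q : ℚ≥0 // q ≤ 1}

/-- Fully probabilistic programs: `v := e`, `P; Q`, `{P} [p] {Q}`, and `WHILE (b) {P}`. -/
inductive Prog
  | assign (v : Var) (e : AExp)
  | seq (P Q : Prog)
  | choice (p : Prob) (P Q : Prog)
  | loop (b : BExp) (P : Prog)

/-! ## Semantics -/

/-- Evaluation of arithmetical expressions; intermediate results may be negative. -/
def AExp.eval (η : Valuation) : AExp → ℚ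
  | .const q => (q : ℚ)
  | .var v => (η v : ℚ)
  | .add e₁ e₂ => e₁.eval η + e₂.eval η
  | .sub e₁ e₂ => e₁.eval η - e₂.eval η
  | .mul e₁ e₂ => e₁.eval η * e₂.eval η

/-- Evaluation of Boolean expressions. -/
def BExp.eval (η : Valuation) : BExp → Bool
  | .eq e₁ e₂ => decide (e₁.eval η = e₂.eval η)
  | .lt e₁ e₂ => decide (e₁.eval η < e₂.eval η)
  | .not b => !b.eval η
  | .and b₁ b₂ => b₁.eval η && b₂.eval η

/-- The control component of a state: the terminated program `↓`, a program, or a residual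
`C; P` in which `C` has already been started (so that `C` may be `↓`). -/
inductive Ctrl
  | down
  | prog (P : Prog)
  | seq (C : Ctrl) (P : Prog)

/-- The two outcomes of a probabilistic choice: `true` is `L`(eft), `false` is `R`(ight). -/
abbrev Dir := Bool

/-- The left branch. -/
abbrev Dir.L : Dir := true

/-- The right branch. -/
abbrev Dir.R : Dir := false

/-- Program states: control, current valuation, probability of the choices made so far, and the
sequence of these choices. -/
structure State where
  ctrl : Ctrl
  val : Valuation
  prob : ℚ≥0
  trace : List Dir

/-- The small-step relation `⊢`. The rule for started concatenations occurs twice, once for a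
program `P; Q` and once for a residual `C; Q`. -/
inductive Step : State → State → Prop
  | assign (v e η a θ) :
      Step ⟨.prog (.assign v e), η, a, θ⟩
        ⟨.down, Function.update η v (max (e.eval η) 0).toNNRat, a, θ⟩
  | concat1 (P Q η a θ C' η' a' θ') (h : Step ⟨.prog P, η, a, θ⟩ ⟨C', η', a', θ'⟩) :
      Step ⟨.prog (.seq P Q), η, a, θ⟩ ⟨.seq C' Q, η', a', θ'⟩
  | concat1' (C Q η a θ C' η' a' θ') (h : Step ⟨C, η, a, θ⟩ ⟨C', η', a', θ'⟩) :
      Step ⟨.seq C Q, η, a, θ⟩ ⟨.seq C' Q, η', a', θ'⟩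
  | concat2 (Q η a θ) : Step ⟨.seq .down Q, η, a, θ⟩ ⟨.prog Q, η, a, θ⟩
  | prob1 (p P Q η a θ) :
      Step ⟨.prog (.choice p P Q), η, a, θ⟩ ⟨.prog P, η, a * p.1, θ ++ [Dir.L]⟩
  | prob2 (p P Q η a θ) :
      Step ⟨.prog (.choice p P Q), η, a, θ⟩ ⟨.prog Q, η, a * (1 - p.1), θ ++ [Dir.R]⟩
  | while1 (b P η a θ) (h : b.eval η = true) :
      Step ⟨.prog (.loop b P), η, a, θ⟩ ⟨.prog (.seq P (.loop b P)), η, a, θ⟩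
  | while2 (b P η a θ) (h : b.eval η = false) :
      Step ⟨.prog (.loop b P), η, a, θ⟩ ⟨.down, η, a, θ⟩

/-- One step from a program, resolving a probabilistic choice by the first letter of `w`; returns
the successor state and the unread rest of `w`. -/
def nextProg (η : Valuation) (a : ℚ≥0) (θ w : List Dir) : Prog → Option (State × List Dir)
  | .assign v e => some (⟨.down, Function.update η v (max (e.eval η) 0).toNNRat, a, θ⟩, w)
  | .seq P Q =>
      (nextProg η a θ w P).map fun r => (⟨.seq r.1.ctrl Q, r.1.val, r.1.prob, r.1.trace⟩, r.2)
  | .choice p P Q =>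
      match w with
      | [] => none
      | true :: w' => some (⟨.prog P, η, a * p.1, θ ++ [Dir.L]⟩, w')
      | false :: w' => some (⟨.prog Q, η, a * (1 - p.1), θ ++ [Dir.R]⟩, w')
  | .loop b P =>
      if b.eval η then some (⟨.prog (.seq P (.loop b P)), η, a, θ⟩, w)
      else some (⟨.down, η, a, θ⟩, w)

/-- One step from an arbitrary control component, in the same manner. -/
def nextCtrl (η : Valuation) (a : ℚ≥0) (θ w : List Dir) : Ctrl → Option (State × List Dir)
  | .down => none
  | .prog P => nextProg η a θ w P
  | .seq .down Q => some (⟨.prog Q, η, a, θ⟩, w)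
  | .seq C Q =>
      (nextCtrl η a θ w C).map fun r => (⟨.seq r.1.ctrl Q, r.1.val, r.1.prob, r.1.trace⟩, r.2)

/-- One step from a state, in the same manner. -/
def next (σ : State) (w : List Dir) : Option (State × List Dir) :=
  nextCtrl σ.val σ.prob σ.trace w σ.ctrl

theorem next_of_step {σ τ : State} (h : Step σ τ) :
    ∃ b : List Dir, τ.trace = σ.trace ++ b ∧ ∀ w', next σ (b ++ w') = some (τ, w') := by
  induction h with
  | assign => exact ⟨[], by simp, fun w' => by simp [next, nextCtrl, nextProg]⟩
  | concat1 P Q η a θ C' η' a' θ' h ih =>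
    obtain ⟨b, hb, hn⟩ := ih
    refine ⟨b, hb, fun w' => ?_⟩
    have := hn w'
    simp only [next, nextCtrl] at this
    simp [next, nextCtrl, nextProg, this]
  | concat1' C Q η a θ C' η' a' θ' h ih =>
    obtain ⟨b, hb, hn⟩ := ih
    refine ⟨b, hb, fun w' => ?_⟩
    have := hn w'
    simp only [next] at this
    cases C with
    | down => cases h
    | prog P => simp [next, nextCtrl] at this ⊢; simp [this]
    | seq C P => simp only [next, nextCtrl]; simp [this]
  | concat2 => exact ⟨[], by simp, fun w' => by simp [next, nextCtrl]⟩
  | prob1 => exact ⟨[Dir.L], rfl, fun w' => by simp [next, nextCtrl, nextProg]⟩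
  | prob2 => exact ⟨[Dir.R], rfl, fun w' => by simp [next, nextCtrl, nextProg]⟩
  | while1 b P η a θ h => exact ⟨[], by simp, fun w' => by simp [next, nextCtrl, nextProg, h]⟩
  | while2 b P η a θ h => exact ⟨[], by simp, fun w' => by simp [next, nextCtrl, nextProg, h]⟩

theorem step_of_nextProg {η a θ w w'} {P : Prog} {τ : State}
    (h : nextProg η a θ w P = some (τ, w')) :
    Step ⟨.prog P, η, a, θ⟩ τ ∧ ∃ b, τ.trace = θ ++ b ∧ w = b ++ w' := by
  induction P generalizing τ w' with
  | assign v e =>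
    simp only [nextProg, Option.some.injEq, Prod.mk.injEq] at h
    obtain ⟨rfl, rfl⟩ := h
    exact ⟨.assign .., [], by simp, rfl⟩
  | seq P Q ihP _ =>
    simp only [nextProg, Option.map_eq_some_iff] at h
    obtain ⟨⟨ρ, u⟩, h1, h2⟩ := h
    simp only [Prod.mk.injEq] at h2
    obtain ⟨rfl, rfl⟩ := h2
    obtain ⟨hs, hb⟩ := ihP h1
    exact ⟨.concat1 _ _ _ _ _ _ _ _ _ hs, hb⟩
  | choice p P Q =>
    rcases w with _ | ⟨_ | _, w⟩
    · simp [nextProg] at h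
    · simp only [nextProg, Option.some.injEq, Prod.mk.injEq] at h
      obtain ⟨rfl, rfl⟩ := h
      exact ⟨.prob2 .., [Dir.R], rfl, rfl⟩
    · simp only [nextProg, Option.some.injEq, Prod.mk.injEq] at h
      obtain ⟨rfl, rfl⟩ := h
      exact ⟨.prob1 .., [Dir.L], rfl, rfl⟩
  | loop b P =>
    simp only [nextProg] at h
    split at h <;> rename_i hb <;> simp only [Option.some.injEq, Prod.mk.injEq] at h <;>
      obtain ⟨rfl, rfl⟩ := h
    · exact ⟨.while1 _ _ _ _ _ hb, [], by simp, rfl⟩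
    · exact ⟨.while2 _ _ _ _ _ (by simpa using hb), [], by simp, rfl⟩

theorem step_of_nextCtrl {η a θ w w'} {C : Ctrl} {τ : State}
    (h : nextCtrl η a θ w C = some (τ, w')) :
    Step ⟨C, η, a, θ⟩ τ ∧ ∃ b, τ.trace = θ ++ b ∧ w = b ++ w' := by
  induction C generalizing τ w' with
  | down => simp [nextCtrl] at h
  | prog P => exact step_of_nextProg h
  | seq C Q ih =>
    by_cases hC : C = .down
    · subst hC
      simp only [nextCtrl, Option.some.injEq, Prod.mk.injEq] at h
      obtain ⟨rfl, rfl⟩ := h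
      exact ⟨.concat2 .., [], by simp, rfl⟩
    · rw [nextCtrl.eq_4 _ _ _ _ _ _ (fun h => hC h), Option.map_eq_some_iff] at h
      obtain ⟨⟨ρ, u⟩, h1, h2⟩ := h
      simp only [Prod.mk.injEq] at h2
      obtain ⟨rfl, rfl⟩ := h2
      obtain ⟨hs, hb⟩ := ih h1
      exact ⟨.concat1' _ _ _ _ _ _ _ _ _ hs, hb⟩

/-- `next` computes the relation `⊢`: it moves from `σ` to `τ` reading `b` off the word iff
`σ ⊢ τ` and `b` is what this step appends to the sequence of choices. -/
theorem next_eq_some_iff {σ τ : State} {w w' : List Dir} :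
    next σ w = some (τ, w') ↔ Step σ τ ∧ ∃ b, τ.trace = σ.trace ++ b ∧ w = b ++ w' := by
  refine ⟨step_of_nextCtrl, ?_⟩
  rintro ⟨h, b, hb, rfl⟩
  obtain ⟨b', hb', hn⟩ := next_of_step h
  obtain rfl : b' = b := List.append_cancel_left (hb'.symm.trans hb)
  exact hn w'

/-- The state successor function `T`: the state reached from `σ` in exactly `k` steps in which
exactly the choices `w` are made, if there is one (`none` plays the role of `⊥`). -/
def T : ℕ → State → List Dir → Option State
  | 0, σ, w => if w = [] then some σ else none
  | k + 1, σ, w => (next σ w).bind fun r => T k r.1 r.2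

/-- The probability stored in a terminal state, and `0` for everything else. -/
def alpha : Option State → ℚ≥0
  | some ⟨.down, _, a, _⟩ => a
  | _ => 0

/-- The initial state of `P` on `η`. -/
def init (P : Prog) (η : Valuation) : State := ⟨.prog P, η, 1, []⟩

/-- The probability that `P` terminates on `η`: the sum over all `k` and all words `w` over
`{L, R}` of length at most `k` of `alpha (T k (init P η) w)`. -/
noncomputable def prTerm (P : Prog) (η : Valuation) : ℝ≥0∞ :=
  ∑' k : ℕ, ∑ i ∈ Finset.range (k + 1), ∑ w : List.Vector Dir i,
    ((alpha (T k (init P η) w.toList) : ℝ≥0) : ℝ≥0∞)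

/-! ## Inputs and the problem `AST` -/

/-- Inputs: the valuations that vanish outside a finite set of variables. -/
structure Input where
  val : Valuation
  finite_support : (Function.support val).Finite

/-- Almost-sure termination on a given input. -/
def AST : Set (Prog × Input) := {x | prTerm x.1 x.2.val = 1}

/-! ## Codings

Every class of objects is coded by natural numbers in the usual way: nonnegative rationals by
numerator and denominator, syntax trees by nested pairs, inputs by the finite list of their
values. Every natural number is the code of some object, and the primitive recursive function
`code ∘ ofCode` sends a number to the canonical code of the object it denotes. -/

/-- The code of a nonnegative rational. -/
def ratCode (q : ℚ≥0) : ℕ := Nat.pair q.num (q.den - 1)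

/-- The nonnegative rational with a given code. -/
def ratOfCode (n : ℕ) : ℚ≥0 := n.unpair.1 / (n.unpair.2 + 1 : ℕ)

theorem ratOfCode_ratCode (q : ℚ≥0) : ratOfCode (ratCode q) = q := by
  have : q.den - 1 + 1 = q.den := Nat.succ_pred_eq_of_pos q.den_pos
  simp only [ratOfCode, ratCode, Nat.unpair_pair, this]
  exact q.num_div_den

theorem primrec_gcd : Primrec₂ fun a b : ℕ => Nat.gcd a (b + 1) := by
  have hd : ∀ f g : (ℕ × ℕ) × ℕ → ℕ, Primrec f → Primrec g →
      PrimrecPred fun x => f x ∣ g x := fun f g hf hg =>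
    (Primrec.eq.comp (Primrec.nat_mod.comp hg hf) (Primrec.const 0)).of_eq
      fun x => (Nat.dvd_iff_mod_eq_zero).symm
  have h : Primrec fun x : ℕ × ℕ =>
      (x.2 + 1).findGreatest (fun d => d ∣ x.1 ∧ d ∣ x.2 + 1) := by
    refine Primrec.nat_findGreatest (Primrec.succ.comp Primrec.snd) ?_
    exact PrimrecPred.and
      (hd _ _ Primrec.snd (Primrec.fst.comp Primrec.fst))
      (hd _ _ Primrec.snd (Primrec.succ.comp (Primrec.snd.comp Primrec.fst)))
  refine h.of_eq fun x => ?_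
  rw [Nat.findGreatest_eq_iff]
  refine ⟨Nat.gcd_le_right _ (Nat.succ_pos _), fun _ => ⟨Nat.gcd_dvd_left .., Nat.gcd_dvd_right ..⟩,
    fun n hn _ hd => ?_⟩
  exact absurd (Nat.le_of_dvd (Nat.gcd_pos_of_pos_right _ (Nat.succ_pos _))
    (Nat.dvd_gcd hd.1 hd.2)) (not_le.2 hn)

theorem ratCode_ratOfCode (n : ℕ) : ratCode (ratOfCode n) =
    Nat.pair (n.unpair.1 / n.unpair.1.gcd (n.unpair.2 + 1))
      ((n.unpair.2 + 1) / n.unpair.1.gcd (n.unpair.2 + 1) - 1) := by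
  have h : ∀ a d : ℕ, 0 < d →
      ((a / d : ℚ≥0).num = a / a.gcd d ∧ (a / d : ℚ≥0).den = d / a.gcd d) := by
    intro a d hd
    have hg : 0 < a.gcd d := Nat.gcd_pos_of_pos_right _ hd
    have hc : Nat.Coprime (a / a.gcd d) (d / a.gcd d) := Nat.coprime_div_gcd_div_gcd hg
    have hd' : 0 < d / a.gcd d := Nat.div_pos (Nat.gcd_le_right _ hd) hg
    have hq : ((a / d : ℚ≥0) : ℚ) =
        (((a / a.gcd d : ℕ) : ℤ) : ℚ) / (((d / a.gcd d : ℕ) : ℤ) : ℚ) := by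
      have hg' : ((a.gcd d : ℕ) : ℚ) ≠ 0 := by exact_mod_cast hg.ne'
      rw [Int.cast_natCast, Int.cast_natCast, Nat.cast_div (Nat.gcd_dvd_left a d) hg',
        Nat.cast_div (Nat.gcd_dvd_right a d) hg', div_div_div_cancel_right₀ hg']
      push_cast
      rfl
    constructor
    · have := Rat.num_div_eq_of_coprime (a := ((a / a.gcd d : ℕ) : ℤ))
        (b := ((d / a.gcd d : ℕ) : ℤ)) (by exact_mod_cast hd') hc
      rw [NNRat.num, hq, this]
      exact Int.natAbs_natCast _
    · have := Rat.den_div_eq_of_coprime (a := ((a / a.gcd d : ℕ) : ℤ))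
        (b := ((d / a.gcd d : ℕ) : ℤ)) (by exact_mod_cast hd') hc
      rw [NNRat.den, hq]
      exact_mod_cast this
  obtain ⟨h1, h2⟩ := h n.unpair.1 (n.unpair.2 + 1) (Nat.succ_pos _)
  simp only [ratCode, ratOfCode, h1, h2]

theorem primrec_ratNorm : Primrec fun n => ratCode (ratOfCode n) := by
  have hg : Primrec fun n : ℕ => n.unpair.1.gcd (n.unpair.2 + 1) :=
    primrec_gcd.comp (Primrec.fst.comp Primrec.unpair) (Primrec.snd.comp Primrec.unpair)
  refine Primrec.of_eq ?_ fun n => (ratCode_ratOfCode n).symm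
  exact Primrec₂.natPair.comp
    (Primrec.nat_div.comp (Primrec.fst.comp Primrec.unpair) hg)
    (Primrec.pred.comp
      (Primrec.nat_div.comp (Primrec.succ.comp (Primrec.snd.comp Primrec.unpair)) hg))

/-- The probability with a given code. -/
def probOfCode (n : ℕ) : Prob := ⟨min (ratOfCode n) 1, min_le_right _ _⟩

theorem probOfCode_ratCode (p : Prob) : probOfCode (ratCode p.1) = p :=
  Subtype.ext (by simp [probOfCode, ratOfCode_ratCode, p.2])

theorem primrec_probNorm : Primrec fun n => ratCode (probOfCode n).1 := by
  have : Primrec fun n : ℕ =>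
      if n.unpair.1 ≤ n.unpair.2 + 1 then ratCode (ratOfCode n) else ratCode 1 :=
    Primrec.ite (Primrec.nat_le.comp (Primrec.fst.comp Primrec.unpair)
      (Primrec.succ.comp (Primrec.snd.comp Primrec.unpair))) primrec_ratNorm (Primrec.const _)
  refine this.of_eq fun n => ?_
  have hiff : ratOfCode n ≤ 1 ↔ n.unpair.1 ≤ n.unpair.2 + 1 := by
    rw [ratOfCode, div_le_one (by positivity)]; exact Nat.cast_le
  split
  · next h => simp only [probOfCode, min_eq_left (hiff.2 h)]
  · next h => simp only [probOfCode, min_eq_right (le_of_not_ge fun h' => h (hiff.1 h'))]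

/-- The code of a tree node with tag `t`, label `l` and the codes `x`, `y` of its children. -/
def node (t l x y : ℕ) : ℕ := Nat.pair t (Nat.pair l (Nat.pair x y))

/-- The tag of a tree code. -/
def ntag (n : ℕ) : ℕ := n.unpair.1

/-- The label of a tree code. -/
def nlab (n : ℕ) : ℕ := n.unpair.2.unpair.1

/-- The first child of a tree code. -/
def nfst (n : ℕ) : ℕ := n.unpair.2.unpair.2.unpair.1

/-- The second child of a tree code. -/
def nsnd (n : ℕ) : ℕ := n.unpair.2.unpair.2.unpair.2

@[simp] theorem ntag_node (t l x y : ℕ) : ntag (node t l x y) = t := by simp [ntag, node]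
@[simp] theorem nlab_node (t l x y : ℕ) : nlab (node t l x y) = l := by simp [nlab, node]
@[simp] theorem nfst_node (t l x y : ℕ) : nfst (node t l x y) = x := by simp [nfst, node]
@[simp] theorem nsnd_node (t l x y : ℕ) : nsnd (node t l x y) = y := by simp [nsnd, node]

theorem nfst_lt {n : ℕ} (h : ntag n ≠ 0) : nfst n < n := by
  have h1 := Nat.unpair_add_le n
  have h2 := Nat.unpair_right_le n.unpair.2
  have h3 := Nat.unpair_left_le n.unpair.2.unpair.2
  simp only [ntag, nfst] at *
  omega

theorem nsnd_lt {n : ℕ} (h : ntag n ≠ 0) : nsnd n < n := by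
  have h1 := Nat.unpair_add_le n
  have h2 := Nat.unpair_right_le n.unpair.2
  have h3 := Nat.unpair_right_le n.unpair.2.unpair.2
  simp only [ntag, nsnd] at *
  omega

theorem primrec_node {α : Type} [Primcodable α] {t l x y : α → ℕ} (ht : Primrec t)
    (hl : Primrec l) (hx : Primrec x) (hy : Primrec y) :
    Primrec fun a => node (t a) (l a) (x a) (y a) :=
  Primrec₂.natPair.comp ht (Primrec₂.natPair.comp hl (Primrec₂.natPair.comp hx hy))

theorem primrec_ntag : Primrec ntag := Primrec.fst.comp Primrec.unpair

theorem primrec_nlab : Primrec nlab :=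
  Primrec.fst.comp (Primrec.unpair.comp (Primrec.snd.comp Primrec.unpair))

theorem primrec_nfst : Primrec nfst :=
  Primrec.fst.comp (Primrec.unpair.comp (Primrec.snd.comp
    (Primrec.unpair.comp (Primrec.snd.comp Primrec.unpair))))

theorem primrec_nsnd : Primrec nsnd :=
  Primrec.snd.comp (Primrec.unpair.comp (Primrec.snd.comp
    (Primrec.unpair.comp (Primrec.snd.comp Primrec.unpair))))

/-- Recursion over tree codes is primitive recursive. -/
theorem primrec_tree {f : ℕ → ℕ} {G : ℕ × ℕ × ℕ × ℕ → ℕ} (hG : Primrec G)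
    (hf : ∀ n, f n = G (ntag n, nlab n, if ntag n = 0 then 0 else f (nfst n),
      if ntag n = 0 then 0 else f (nsnd n))) : Primrec f := by
  have len : Primrec fun x : Unit × List ℕ => x.2.length := Primrec.list_length.comp Primrec.snd
  have child : ∀ c : ℕ → ℕ, Primrec c → Primrec fun x : Unit × List ℕ =>
      if ntag x.2.length = 0 then 0 else x.2.getD (c x.2.length) 0 := fun c hc =>
    Primrec.ite (Primrec.eq.comp (primrec_ntag.comp len) (Primrec.const 0)) (Primrec.const 0)
      ((Primrec.list_getD 0).comp Primrec.snd (hc.comp len))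
  have key : Primrec₂ fun (_ : Unit) n => f n := by
    refine Primrec.nat_strong_rec _ (g := fun _ l => some (G (ntag l.length, nlab l.length,
      if ntag l.length = 0 then 0 else l.getD (nfst l.length) 0,
      if ntag l.length = 0 then 0 else l.getD (nsnd l.length) 0))) ?_ ?_
    · exact Primrec.option_some.comp (hG.comp (Primrec.pair (primrec_ntag.comp len)
        (Primrec.pair (primrec_nlab.comp len)
          (Primrec.pair (child _ primrec_nfst) (child _ primrec_nsnd)))))
    · intro _ n
      simp only [List.length_map, List.length_range]
      rw [hf n]
      by_cases h : ntag n = 0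
      · simp [h]
      · simp [h, List.getD, nfst_lt h, nsnd_lt h]
  exact key.comp (Primrec.const ()) Primrec.id

/-- The code of an arithmetical expression. -/
def AExp.code : AExp → ℕ
  | .const q => node 0 (ratCode q) 0 0
  | .var v => node 1 v 0 0
  | .add e₁ e₂ => node 2 0 e₁.code e₂.code
  | .sub e₁ e₂ => node 3 0 e₁.code e₂.code
  | .mul e₁ e₂ => node 4 0 e₁.code e₂.code

/-- The arithmetical expression with a given code. -/
def AExp.ofCode (n : ℕ) : AExp :=
  if ntag n = 0 then .const (ratOfCode (nlab n))
  else if ntag n = 1 then .var (nlab n)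
  else if ntag n = 2 then .add (AExp.ofCode (nfst n)) (AExp.ofCode (nsnd n))
  else if ntag n = 3 then .sub (AExp.ofCode (nfst n)) (AExp.ofCode (nsnd n))
  else .mul (AExp.ofCode (nfst n)) (AExp.ofCode (nsnd n))
termination_by n
decreasing_by all_goals first
  | with_reducible exact nfst_lt (by assumption)
  | with_reducible exact nsnd_lt (by assumption)

theorem AExp.ofCode_code (e : AExp) : AExp.ofCode e.code = e := by
  induction e with
  | const q => rw [AExp.ofCode]; simp [AExp.code, ratOfCode_ratCode]
  | var v => rw [AExp.ofCode]; simp [AExp.code]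
  | add _ _ h₁ h₂ => rw [AExp.ofCode]; simp [AExp.code, h₁, h₂]
  | sub _ _ h₁ h₂ => rw [AExp.ofCode]; simp [AExp.code, h₁, h₂]
  | mul _ _ h₁ h₂ => rw [AExp.ofCode]; simp [AExp.code, h₁, h₂]

theorem primrec_tagIs (k : ℕ) : PrimrecPred fun x : ℕ × ℕ × ℕ × ℕ => x.1 = k :=
  Primrec.eq.comp Primrec.fst (Primrec.const k)

theorem AExp.primrec_norm : Primrec fun n => (AExp.ofCode n).code := by
  have l : Primrec fun x : ℕ × ℕ × ℕ × ℕ => x.2.1 := Primrec.fst.comp Primrec.snd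
  have c : Primrec fun x : ℕ × ℕ × ℕ × ℕ => x.2.2.1 :=
    Primrec.fst.comp (Primrec.snd.comp Primrec.snd)
  have d : Primrec fun x : ℕ × ℕ × ℕ × ℕ => x.2.2.2 :=
    Primrec.snd.comp (Primrec.snd.comp Primrec.snd)
  have k : ∀ m : ℕ, Primrec fun _ : ℕ × ℕ × ℕ × ℕ => m := fun m => Primrec.const m
  refine primrec_tree (G := fun x =>
    if x.1 = 0 then node 0 (ratCode (ratOfCode x.2.1)) 0 0
    else if x.1 = 1 then node 1 x.2.1 0 0
    else if x.1 = 2 then node 2 0 x.2.2.1 x.2.2.2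
    else if x.1 = 3 then node 3 0 x.2.2.1 x.2.2.2
    else node 4 0 x.2.2.1 x.2.2.2) ?_ ?_
  · exact Primrec.ite (primrec_tagIs 0) (primrec_node (k 0) (primrec_ratNorm.comp l) (k 0) (k 0))
      (Primrec.ite (primrec_tagIs 1) (primrec_node (k 1) l (k 0) (k 0))
        (Primrec.ite (primrec_tagIs 2) (primrec_node (k 2) (k 0) c d)
          (Primrec.ite (primrec_tagIs 3) (primrec_node (k 3) (k 0) c d)
            (primrec_node (k 4) (k 0) c d))))
  · intro n
    rw [AExp.ofCode]
    by_cases h0 : ntag n = 0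
    · simp [h0, AExp.code]
    by_cases h1 : ntag n = 1
    · simp [h1, AExp.code]
    by_cases h2 : ntag n = 2
    · simp [h2, AExp.code]
    by_cases h3 : ntag n = 3
    · simp [h3, AExp.code]
    simp [h0, h1, h2, h3, AExp.code]

/-- The code of a Boolean expression. -/
def BExp.code : BExp → ℕ
  | .eq e₁ e₂ => node 0 (Nat.pair e₁.code e₂.code) 0 0
  | .lt e₁ e₂ => node 1 (Nat.pair e₁.code e₂.code) 0 0
  | .not b => node 2 0 b.code 0
  | .and b₁ b₂ => node 3 0 b₁.code b₂.code

/-- The Boolean expression with a given code. -/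
def BExp.ofCode (n : ℕ) : BExp :=
  if ntag n = 0 then .eq (AExp.ofCode (nlab n).unpair.1) (AExp.ofCode (nlab n).unpair.2)
  else if ntag n = 1 then .lt (AExp.ofCode (nlab n).unpair.1) (AExp.ofCode (nlab n).unpair.2)
  else if ntag n = 2 then .not (BExp.ofCode (nfst n))
  else .and (BExp.ofCode (nfst n)) (BExp.ofCode (nsnd n))
termination_by n
decreasing_by all_goals first
  | with_reducible exact nfst_lt (by assumption)
  | with_reducible exact nsnd_lt (by assumption)

theorem BExp.ofCode_code (b : BExp) : BExp.ofCode b.code = b := by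
  induction b with
  | eq e₁ e₂ => rw [BExp.ofCode]; simp [BExp.code, AExp.ofCode_code]
  | lt e₁ e₂ => rw [BExp.ofCode]; simp [BExp.code, AExp.ofCode_code]
  | not _ h => rw [BExp.ofCode]; simp [BExp.code, h]
  | and _ _ h₁ h₂ => rw [BExp.ofCode]; simp [BExp.code, h₁, h₂]

theorem BExp.primrec_norm : Primrec fun n => (BExp.ofCode n).code := by
  have l : Primrec fun x : ℕ × ℕ × ℕ × ℕ =>
      Nat.pair (AExp.ofCode x.2.1.unpair.1).code (AExp.ofCode x.2.1.unpair.2).code :=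
    Primrec₂.natPair.comp
      (AExp.primrec_norm.comp (Primrec.fst.comp (Primrec.unpair.comp
        (Primrec.fst.comp Primrec.snd))))
      (AExp.primrec_norm.comp (Primrec.snd.comp (Primrec.unpair.comp
        (Primrec.fst.comp Primrec.snd))))
  have c : Primrec fun x : ℕ × ℕ × ℕ × ℕ => x.2.2.1 :=
    Primrec.fst.comp (Primrec.snd.comp Primrec.snd)
  have d : Primrec fun x : ℕ × ℕ × ℕ × ℕ => x.2.2.2 :=
    Primrec.snd.comp (Primrec.snd.comp Primrec.snd)
  have k : ∀ m : ℕ, Primrec fun _ : ℕ × ℕ × ℕ × ℕ => m := fun m => Primrec.const m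
  refine primrec_tree (G := fun x =>
    if x.1 = 0 then node 0
      (Nat.pair (AExp.ofCode x.2.1.unpair.1).code (AExp.ofCode x.2.1.unpair.2).code) 0 0
    else if x.1 = 1 then node 1
      (Nat.pair (AExp.ofCode x.2.1.unpair.1).code (AExp.ofCode x.2.1.unpair.2).code) 0 0
    else if x.1 = 2 then node 2 0 x.2.2.1 0
    else node 3 0 x.2.2.1 x.2.2.2) ?_ ?_
  · exact Primrec.ite (primrec_tagIs 0) (primrec_node (k 0) l (k 0) (k 0))
      (Primrec.ite (primrec_tagIs 1) (primrec_node (k 1) l (k 0) (k 0))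
        (Primrec.ite (primrec_tagIs 2) (primrec_node (k 2) (k 0) c (k 0))
          (primrec_node (k 3) (k 0) c d)))
  · intro n
    rw [BExp.ofCode]
    by_cases h0 : ntag n = 0
    · simp [h0, BExp.code]
    by_cases h1 : ntag n = 1
    · simp [h1, BExp.code]
    by_cases h2 : ntag n = 2
    · simp [h2, BExp.code]
    simp [h0, h1, h2, BExp.code]

/-- The code of a program. -/
def Prog.code : Prog → ℕ
  | .assign v e => node 0 (Nat.pair v e.code) 0 0
  | .seq P Q => node 1 0 P.code Q.code
  | .choice p P Q => node 2 (ratCode p.1) P.code Q.code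
  | .loop b P => node 3 b.code P.code 0

/-- The program with a given code. -/
def Prog.ofCode (n : ℕ) : Prog :=
  if ntag n = 0 then .assign (nlab n).unpair.1 (AExp.ofCode (nlab n).unpair.2)
  else if ntag n = 1 then .seq (Prog.ofCode (nfst n)) (Prog.ofCode (nsnd n))
  else if ntag n = 2 then
    .choice (probOfCode (nlab n)) (Prog.ofCode (nfst n)) (Prog.ofCode (nsnd n))
  else .loop (BExp.ofCode (nlab n)) (Prog.ofCode (nfst n))
termination_by n
decreasing_by all_goals first
  | with_reducible exact nfst_lt (by assumption)
  | with_reducible exact nsnd_lt (by assumption)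

theorem Prog.ofCode_code (P : Prog) : Prog.ofCode P.code = P := by
  induction P with
  | assign v e => rw [Prog.ofCode]; simp [Prog.code, AExp.ofCode_code]
  | seq _ _ h₁ h₂ => rw [Prog.ofCode]; simp [Prog.code, h₁, h₂]
  | choice p _ _ h₁ h₂ => rw [Prog.ofCode]; simp [Prog.code, h₁, h₂, probOfCode_ratCode]
  | loop b _ h => rw [Prog.ofCode]; simp [Prog.code, h, BExp.ofCode_code]

theorem Prog.primrec_norm : Primrec fun n => (Prog.ofCode n).code := by
  have l : Primrec fun x : ℕ × ℕ × ℕ × ℕ => x.2.1 := Primrec.fst.comp Primrec.snd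
  have c : Primrec fun x : ℕ × ℕ × ℕ × ℕ => x.2.2.1 :=
    Primrec.fst.comp (Primrec.snd.comp Primrec.snd)
  have d : Primrec fun x : ℕ × ℕ × ℕ × ℕ => x.2.2.2 :=
    Primrec.snd.comp (Primrec.snd.comp Primrec.snd)
  have k : ∀ m : ℕ, Primrec fun _ : ℕ × ℕ × ℕ × ℕ => m := fun m => Primrec.const m
  refine primrec_tree (G := fun x =>
    if x.1 = 0 then node 0 (Nat.pair x.2.1.unpair.1 (AExp.ofCode x.2.1.unpair.2).code) 0 0
    else if x.1 = 1 then node 1 0 x.2.2.1 x.2.2.2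
    else if x.1 = 2 then node 2 (ratCode (probOfCode x.2.1).1) x.2.2.1 x.2.2.2
    else node 3 (BExp.ofCode x.2.1).code x.2.2.1 0) ?_ ?_
  · exact Primrec.ite (primrec_tagIs 0) (primrec_node (k 0)
        (Primrec₂.natPair.comp (Primrec.fst.comp (Primrec.unpair.comp l))
          (AExp.primrec_norm.comp (Primrec.snd.comp (Primrec.unpair.comp l)))) (k 0) (k 0))
      (Primrec.ite (primrec_tagIs 1) (primrec_node (k 1) (k 0) c d)
        (Primrec.ite (primrec_tagIs 2) (primrec_node (k 2) (primrec_probNorm.comp l) c d)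
          (primrec_node (k 3) (BExp.primrec_norm.comp l) c (k 0))))
  · intro n
    rw [Prog.ofCode]
    by_cases h0 : ntag n = 0
    · simp [h0, Prog.code]
    by_cases h1 : ntag n = 1
    · simp [h1, Prog.code]
    by_cases h2 : ntag n = 2
    · simp [h2, Prog.code]
    simp [h0, h1, h2, Prog.code]

instance : Primcodable Prog where
  encode := Prog.code
  decode n := some (Prog.ofCode n)
  encodek P := congrArg some P.ofCode_code
  prim := Nat.Primrec.succ.comp (Primrec.nat_iff.1 Prog.primrec_norm)

/-- The length of the shortest initial segment of the variables outside which `η` vanishes. -/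
noncomputable def inputLen (η : Input) : ℕ := η.finite_support.toFinset.sup Nat.succ

/-- The list of the codes of the values of an input on this segment. -/
noncomputable def inputList (η : Input) : List ℕ :=
  (List.range (inputLen η)).map fun v => ratCode (η.val v)

/-- The input with a given list of codes of values. -/
def inputOfList (l : List ℕ) : Input where
  val v := ratOfCode (l.getD v 0)
  finite_support := (Set.finite_lt_nat l.length).subset fun v h => by
    by_contra hv
    rw [Set.mem_ofPred_eq, not_lt] at hv
    exact h (by simp [List.getD, hv, ratOfCode])

theorem inputLen_le_iff {η : Input} {m : ℕ} : inputLen η ≤ m ↔ ∀ v, m ≤ v → η.val v = 0 := by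
  rw [inputLen, Finset.sup_le_iff]
  simp only [Set.Finite.mem_toFinset, Function.mem_support, Nat.succ_le_iff]
  exact forall_congr' fun v => by rw [← not_lt, not_imp_comm]

theorem inputOfList_inputList (η : Input) : inputOfList (inputList η) = η := by
  have h : (inputOfList (inputList η)).val = η.val := by
    funext v
    by_cases hv : v < inputLen η
    · simp [inputOfList, inputList, List.getD, hv, ratOfCode_ratCode]
    · simp [inputOfList, inputList, List.getD, hv, inputLen_le_iff.1 le_rfl v (not_lt.1 hv),
        ratOfCode]
  cases η
  cases hη : inputOfList _
  simp_all

theorem inputLen_inputOfList (l : List ℕ) : inputLen (inputOfList l) =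
    l.length.findGreatest (fun m => (l.getD (m - 1) 0).unpair.1 ≠ 0) := by
  have h0 : ∀ v, (inputOfList l).val v = 0 ↔ (l.getD v 0).unpair.1 = 0 := fun v => by
    simp only [inputOfList, ratOfCode, div_eq_zero_iff, Nat.cast_eq_zero, Nat.succ_ne_zero,
      or_false]
  apply le_antisymm
  · rw [inputLen_le_iff]
    intro v hv
    by_contra h
    have hl : v < l.length := by
      by_contra hl
      exact h (by simp [inputOfList, List.getD, not_lt.1 hl, ratOfCode])
    have := Nat.le_findGreatest (P := fun m => (l.getD (m - 1) 0).unpair.1 ≠ 0)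
      (Nat.succ_le_of_lt hl) (by simpa using fun h' => h ((h0 v).2 h'))
    omega
  · by_contra hlt
    rw [not_le] at hlt
    have := Nat.findGreatest_of_ne_zero (P := fun m => (l.getD (m - 1) 0).unpair.1 ≠ 0) rfl
      (Nat.ne_of_gt (lt_of_le_of_lt (Nat.zero_le _) hlt))
    exact this ((h0 _).1 (inputLen_le_iff.1 le_rfl _ (Nat.le_sub_one_of_lt hlt)))

theorem primrec_inputNorm : Primrec fun l => inputList (inputOfList l) := by
  have hlen : Primrec fun l => inputLen (inputOfList l) := by
    refine Primrec.of_eq ?_ fun l => (inputLen_inputOfList l).symm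
    refine Primrec.nat_findGreatest (p := fun (l : List ℕ) m => (l.getD (m - 1) 0).unpair.1 ≠ 0)
      Primrec.list_length (PrimrecPred.not ?_)
    exact Primrec.eq.comp (Primrec.fst.comp (Primrec.unpair.comp ((Primrec.list_getD 0).comp
      Primrec.fst (Primrec.pred.comp Primrec.snd)))) (Primrec.const 0)
  refine Primrec.list_map (Primrec.list_range.comp hlen) ?_
  exact primrec_ratNorm.comp (Primrec.list_getD 0)

noncomputable instance : Primcodable Input where
  encode η := Encodable.encode (inputList η)
  decode n := some (inputOfList (Denumerable.ofNat (List ℕ) n))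
  encodek η := by simp [inputOfList_inputList]
  prim := Nat.Primrec.succ.comp (Primrec.nat_iff.1
    (Primrec.encode.comp (primrec_inputNorm.comp (Primrec.ofNat (List ℕ)))))

end PGCL

/-! Membership. A step of a running program is either deterministic or a choice between two
successors of weights `p` and `1 - p`. Hence the probability `haltProb k` of halting after exactly
`k` steps is a finite sum of rationals. `prTerm` is the sum of these over `k` (`prTerm_eq`), since a
run of `k` steps reads at most `k` letters. Each `haltProb k` is primitive recursive in `k` and the
configuration (`primrec_haltProb`). The total never exceeds 1, so it equals 1 exactly if for every
`m` some partial sum exceeds `m / (m + 1)`, which is a `Π₂⁰` condition (`haltTotal_eq_one_iff`).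

Hardness. A `Π₂⁰` set has the form `∀ y, ∃ z, h ⟨x, ⟨y, z⟩⟩ = 0` with `h` primitive recursive
(`IsPi2.exists_primrec`), and some program `H` computes `h` by deterministic runs
(`exists_computesAt`). For `y = 0, 1, …` in turn, `hardProg H` searches for such a `z` and after
each success tosses a fair coin to stop or to go on. If every search succeeds, the probability of
still running after `n` rounds is `2⁻ⁿ`, so termination is almost sure
(`haltTotal_hardProg_eq_one`). If some search is infinite, the first such search is reached with
positive probability and that mass never halts (`haltTotal_hardProg_lt_one`). The program depends
only on the set; `x` enters through the input alone. -/

namespace PGCL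

/-! ## A stack machine for the small-step semantics -/

/-- The input `η` with the value of `v` changed to `q`. -/
def Input.update (η : Input) (v : Var) (q : ℚ≥0) : Input where
  val := Function.update η.val v q
  finite_support := (η.finite_support.insert v).subset fun u hu => by
    by_cases h : u = v
    · exact Or.inl h
    · exact Or.inr (by simpa [Function.update_of_ne h] using hu)

@[simp] theorem Input.val_update (η : Input) (v : Var) (q : ℚ≥0) :
    (η.update v q).val = Function.update η.val v q := rfl

/-- A running program (or `none` if it has terminated), the stack of programs to be run after it,
and the current valuation. -/
abbrev Config := (Option Prog × List Prog) × Input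

/-- The control component denoted by a stack. -/
def stackCtrl (c : Option Prog × List Prog) : Ctrl := c.2.foldl Ctrl.seq (c.1.elim .down .prog)

/-- Put `K` below the stack of a weighted configuration. -/
def pushStack (K : List Prog) (r : ℚ≥0 × Config) : ℚ≥0 × Config :=
  (r.1, (r.2.1.1, r.2.1.2 ++ K), r.2.2)

/-- The successors of a program, weighted by their probabilities. -/
def progSuccs (η : Input) : Prog → List (ℚ≥0 × Config)
  | .assign v e => [(1, (none, []), η.update v (max (e.eval η.val) 0).toNNRat)]
  | .seq P Q => (progSuccs η P).map (pushStack [Q])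
  | .choice p P Q => [(p.1, (some P, []), η), (1 - p.1, (some Q, []), η)]
  | .loop b P => if b.eval η.val then [(1, (some (.seq P (.loop b P)), []), η)]
      else [(1, (none, []), η)]

/-- The successors of a configuration, weighted by their probabilities. -/
def succs : Config → List (ℚ≥0 × Config)
  | ((none, []), _) => []
  | ((none, Q :: K), η) => [(1, (some Q, K), η)]
  | ((some P, K), η) => (progSuccs η P).map (pushStack K)

/-- The state function `N` has exactly the weighted successors `L`. -/
def StepsAs (N : ℚ≥0 → List Dir → List Dir → Option (State × List Dir))
    (L : List (ℚ≥0 × Config)) : Prop :=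
  (∃ c : Config, L = [(1, c)] ∧
    ∀ a θ w, N a θ w = some (⟨stackCtrl c.1, c.2.val, a, θ⟩, w)) ∨
  (∃ (p : Prob) (c d : Config), L = [(p.1, c), (1 - p.1, d)] ∧ ∀ a θ, N a θ [] = none ∧
    ∀ w, N a θ (true :: w) = some (⟨stackCtrl c.1, c.2.val, a * p.1, θ ++ [Dir.L]⟩, w) ∧
      N a θ (false :: w) = some (⟨stackCtrl d.1, d.2.val, a * (1 - p.1), θ ++ [Dir.R]⟩, w))

theorem stackCtrl_concat (o : Option Prog) (K : List Prog) (Q : Prog) :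
    stackCtrl (o, K ++ [Q]) = .seq (stackCtrl (o, K)) Q := by
  simp [stackCtrl]

theorem pushStack_pushStack (K K' : List Prog) (r : ℚ≥0 × Config) :
    pushStack K' (pushStack K r) = pushStack (K ++ K') r := by
  simp [pushStack]

/-- Wrapping the control in `Ctrl.seq _ Q` amounts to placing `Q` at the bottom of the stack;
weights and letters read do not change. -/
theorem StepsAs.push {N L} (h : StepsAs N L) (Q : Prog) :
    StepsAs (fun a θ w => (N a θ w).map fun r =>
      (⟨.seq r.1.ctrl Q, r.1.val, r.1.prob, r.1.trace⟩, r.2)) (L.map (pushStack [Q])) := by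
  rcases h with ⟨c, rfl, h⟩ | ⟨p, c, d, rfl, h⟩
  · exact Or.inl ⟨_, rfl, fun a θ w => by simp [h, stackCtrl_concat]⟩
  · exact Or.inr ⟨p, _, _, rfl, fun a θ => ⟨by simp [(h a θ).1], fun w => by
      simp [((h a θ).2 w).1, ((h a θ).2 w).2, stackCtrl_concat]⟩⟩

theorem stepsAs_nextProg (η : Input) (P : Prog) :
    StepsAs (fun a θ w => nextProg η.val a θ w P) (progSuccs η P) := by
  induction P with
  | assign v e => exact Or.inl ⟨_, rfl, fun a θ w => rfl⟩
  | seq P Q ih => exact ih.push Q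
  | choice p P Q => exact Or.inr ⟨p, _, _, rfl, fun a θ => ⟨rfl, fun w => ⟨rfl, rfl⟩⟩⟩
  | loop b P =>
    by_cases h : b.eval η.val
    · exact Or.inl ⟨_, by simp [progSuccs, h]; rfl, fun a θ w => by simp [nextProg, h, stackCtrl]⟩
    · exact Or.inl ⟨_, by simp [progSuccs, h]; rfl, fun a θ w => by simp [nextProg, h, stackCtrl]⟩

theorem stackCtrl_eq_down {c : Option Prog × List Prog} (h : stackCtrl c = .down) :
    c = (none, []) := by
  obtain ⟨o, K⟩ := c
  rcases List.eq_nil_or_concat K with rfl | ⟨K, Q, rfl⟩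
  · cases o <;> simp_all [stackCtrl]
  · rw [List.concat_eq_append, stackCtrl_concat] at h; cases h

theorem stepsAs_nextCtrl (η : Input) (c : Option Prog × List Prog) (hc : c ≠ (none, [])) :
    StepsAs (fun a θ w => nextCtrl η.val a θ w (stackCtrl c)) (succs (c, η)) := by
  obtain ⟨o, K⟩ := c
  -- The outermost `Ctrl.seq` carries the bottom of the stack, so the induction removes the last
  -- entry.
  induction K using List.reverseRecOn with
  | nil =>
    cases o with
    | none => exact absurd rfl hc
    | some P =>
      have : (progSuccs η P).map (pushStack []) = progSuccs η P := by
        rw [show pushStack [] = id from funext fun r => by simp [pushStack], List.map_id]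
      rw [succs, this]
      exact stepsAs_nextProg η P
  | append_singleton K Q ih =>
    rw [stackCtrl_concat]
    -- This is the only case in which the control is `↓; Q`, where the residual is dropped instead
    -- of the inner control moving.
    by_cases h : (o, K) = (none, [])
    · obtain ⟨rfl, rfl⟩ := Prod.mk.inj h
      exact Or.inl ⟨_, rfl, fun a θ w => rfl⟩
    · have h1 := (ih h).push Q
      have h2 : ∀ a θ w, nextCtrl η.val a θ w (.seq (stackCtrl (o, K)) Q) =
          (nextCtrl η.val a θ w (stackCtrl (o, K))).map fun r =>
            (⟨.seq r.1.ctrl Q, r.1.val, r.1.prob, r.1.trace⟩, r.2) := fun a θ w =>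
        nextCtrl.eq_4 _ _ _ _ _ _ fun h' => h (stackCtrl_eq_down h')
      simp only [h2]
      convert h1 using 1
      rcases o with _ | P
      · rcases K with _ | ⟨R, K⟩
        · exact absurd rfl h
        · rfl
      · simp [succs, pushStack_pushStack]

/-! ### Halting probabilities of configurations. -/

/-- Whether a configuration has halted. -/
def halted (c : Config) : Bool := c.1.1.isNone && c.1.2.isEmpty

theorem halted_iff {c : Config} : halted c = true ↔ c.1 = (none, []) := by
  simp [halted, Prod.ext_iff]

/-- The probability that a configuration halts after exactly `k` steps. -/
def haltProb : ℕ → Config → ℚ≥0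
  | 0, c => if halted c then 1 else 0
  | k + 1, c => ((succs c).map fun r => r.1 * haltProb k r.2).sum

theorem tsum_list_bool (f : List Bool → ℝ≥0∞) :
    ∑' w, f w = f [] + (∑' w, f (true :: w) + ∑' w, f (false :: w)) := by
  let e : Unit ⊕ (Bool × List Bool) ≃ List Bool :=
    { toFun := fun o => o.elim (fun _ => []) fun x => x.1 :: x.2
      invFun := fun w => match w with
        | [] => .inl ()
        | b :: w => .inr (b, w)
      left_inv := by rintro (_ | ⟨b, w⟩) <;> rfl
      right_inv := by rintro (_ | ⟨b, w⟩) <;> rfl }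
  rw [← e.tsum_eq, Summable.tsum_sum ENNReal.summable ENNReal.summable, ENNReal.tsum_prod',
    tsum_bool, add_comm (∑' w, f (e (.inr (false, w)))), tsum_fintype]
  simp [e]

/-- Summing over words of every length makes the induction uniform: a deterministic step leaves the
word alone, and a choice splits the sum by the first letter. The accumulated probability `a` factors
out and the past choices `θ` play no role. -/
theorem tsum_alpha_T (k : ℕ) (c : Config) (a : ℚ≥0) (θ : List Dir) :
    ∑' w, ((alpha (T k ⟨stackCtrl c.1, c.2.val, a, θ⟩ w) : ℝ≥0) : ℝ≥0∞) =
      ((a : ℝ≥0) : ℝ≥0∞) * ((haltProb k c : ℝ≥0) : ℝ≥0∞) := by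
  induction k generalizing c a θ with
  | zero =>
    rw [tsum_list_bool]
    simp only [T, reduceIte, reduceCtorEq, haltProb]
    by_cases h : c.1 = (none, [])
    · simp [h, halted_iff.2 h, stackCtrl, alpha]
    · have : stackCtrl c.1 ≠ .down := fun h' => h (stackCtrl_eq_down h')
      revert this
      cases stackCtrl c.1 <;> simp [alpha, halted_iff.not.2 h]
  | succ k ih =>
    obtain ⟨c, η⟩ := c
    by_cases h : c = (none, [])
    · subst h
      simp [T, next, stackCtrl, nextCtrl, haltProb, succs, alpha]
    · simp only [T, next, haltProb]
      rcases stepsAs_nextCtrl η c h with ⟨d, hL, hN⟩ | ⟨p, d, d', hL, hN⟩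
      · simp only [hL, hN, Option.bind_some, ih]
        simp
      · rw [tsum_list_bool]
        simp only [hL, (hN a θ).1, ((hN a θ).2 _).1, ((hN a θ).2 _).2, Option.bind_some, ih]
        simp [alpha]
        ring

/-- Each step consumes at most one letter and `T` requires the whole word to be consumed. This makes
the sum over words of length at most `k` equal to the sum over all words. -/
theorem T_eq_none_of_length {k : ℕ} {σ : State} {w : List Dir} (h : k < w.length) :
    T k σ w = none := by
  induction k generalizing σ w with
  | zero => simp [T, List.ne_nil_of_length_pos h]
  | succ k ih =>
    rw [T]
    cases hn : next σ w with
    | none => rfl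
    | some r =>
      have hs : ∀ {σ τ : State}, Step σ τ → τ.trace.length ≤ σ.trace.length + 1 := by
        intro σ τ hs
        induction hs <;> simp_all
      obtain ⟨h1, b, hb, rfl⟩ := next_eq_some_iff.1 hn
      have := hs h1
      rw [hb] at this
      simp only [List.length_append] at this h
      exact ih (by omega)

/-- The initial configuration of `P` on `η`. -/
def initConfig (P : Prog) (η : Input) : Config := ((some P, []), η)

theorem prTerm_eq (P : Prog) (η : Input) :
    prTerm P η.val = ∑' k, ((haltProb k (initConfig P η) : ℝ≥0) : ℝ≥0∞) := by
  refine tsum_congr fun k => ?_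
  have h := tsum_alpha_T k (initConfig P η) 1 []
  rw [NNRat.cast_one, ENNReal.coe_one, one_mul] at h
  -- Words are grouped by length; the fibre over `i` is `List.Vector Dir i`.
  rw [← h, ← (Equiv.sigmaFiberEquiv (List.length (α := Dir))).tsum_eq, ENNReal.tsum_sigma',
    tsum_eq_sum (s := Finset.range (k + 1))]
  · refine Finset.sum_congr rfl fun i _ => ?_
    exact (tsum_fintype (L := .unconditional _) fun w : List.Vector Dir i => _).symm
  · intro i hi
    simp only [ENNReal.tsum_eq_zero]
    rintro ⟨w, rfl⟩
    rw [Equiv.sigmaFiberEquiv_apply, T_eq_none_of_length (by simpa using hi)]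
    simp [alpha]

/-- The probability that a configuration halts. -/
noncomputable def haltTotal (c : Config) : ℝ≥0∞ := ∑' k, ((haltProb k c : ℝ≥0) : ℝ≥0∞)

theorem prTerm_eq_haltTotal (P : Prog) (η : Input) :
    prTerm P η.val = haltTotal (initConfig P η) := prTerm_eq P η

theorem succs_cases (c : Config) : (succs c = [] ∧ c.1 = (none, [])) ∨ ((c.1 ≠ (none, [])) ∧
    ((∃ d, succs c = [(1, d)]) ∨ ∃ (p : Prob) (d d' : Config),
      succs c = [(p.1, d), (1 - p.1, d')])) := by
  obtain ⟨c, η⟩ := c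
  by_cases h : c = (none, [])
  · subst h; exact Or.inl ⟨rfl, rfl⟩
  · refine Or.inr ⟨h, ?_⟩
    rcases stepsAs_nextCtrl η c h with ⟨d, hL, -⟩ | ⟨p, d, d', hL, -⟩
    · exact Or.inl ⟨d, hL⟩
    · exact Or.inr ⟨p, d, d', hL⟩

/-- A halted configuration contributes only at time 0, a running one only at later times, and its
successors have total weight 1. -/
theorem sum_haltProb_le_one (k : ℕ) (c : Config) : ∑ i ∈ Finset.range k, haltProb i c ≤ 1 := by
  induction k generalizing c with
  | zero => simp
  | succ k ih =>
    rw [Finset.sum_range_succ']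
    rcases succs_cases c with ⟨h, h'⟩ | ⟨h', ⟨d, h⟩ | ⟨p, d, d', h⟩⟩
    · simp [haltProb, h, halted]
      split <;> simp
    · simpa [haltProb, h, halted_iff, h'] using ih d
    · simp only [haltProb, h, halted_iff, h', List.map_cons, List.map_nil, List.sum_cons, List.sum_nil,
        add_zero, Finset.sum_add_distrib, ← Finset.mul_sum, if_false]
      calc p.1 * _ + (1 - p.1) * _ ≤ p.1 * 1 + (1 - p.1) * 1 := by gcongr <;> apply ih
        _ = 1 := by rw [mul_one, mul_one, add_tsub_cancel_of_le p.2]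

theorem haltTotal_le_one (c : Config) : haltTotal c ≤ 1 := by
  refine ENNReal.tsum_le_of_sum_range_le fun k => ?_
  have := sum_haltProb_le_one k c
  have h : ((∑ i ∈ Finset.range k, haltProb i c : ℚ≥0) : ℝ≥0) ≤ 1 := by exact_mod_cast this
  rw [NNRat.cast_sum] at h
  exact_mod_cast h

end PGCL

namespace PGCL

/-! ## The semantics is primitive recursive -/

instance : Primcodable ℚ≥0 where
  encode := ratCode
  decode n := some (ratOfCode n)
  encodek q := congrArg some (ratOfCode_ratCode q)
  prim := Nat.Primrec.succ.comp (Primrec.nat_iff.1 primrec_ratNorm)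

instance : Primcodable AExp where
  encode := AExp.code
  decode n := some (AExp.ofCode n)
  encodek e := congrArg some e.ofCode_code
  prim := Nat.Primrec.succ.comp (Primrec.nat_iff.1 AExp.primrec_norm)

instance : Primcodable BExp where
  encode := BExp.code
  decode n := some (BExp.ofCode n)
  encodek b := congrArg some b.ofCode_code
  prim := Nat.Primrec.succ.comp (Primrec.nat_iff.1 BExp.primrec_norm)

theorem primrec_ratCode : Primrec ratCode := Primrec.encode

/-- A decoder is primitive recursive as soon as its composition with the coding is, and that is the
normalization map; the other decoders below follow the same pattern. -/
theorem primrec_ratOfCode : Primrec ratOfCode := Primrec.encode_iff.1 primrec_ratNorm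

theorem AExp.primrec_code : Primrec AExp.code := Primrec.encode

theorem AExp.primrec_ofCode : Primrec AExp.ofCode := Primrec.encode_iff.1 AExp.primrec_norm

theorem BExp.primrec_code : Primrec BExp.code := Primrec.encode

theorem BExp.primrec_ofCode : Primrec BExp.ofCode := Primrec.encode_iff.1 BExp.primrec_norm

theorem Prog.primrec_code : Primrec Prog.code := Primrec.encode

theorem Prog.primrec_ofCode : Primrec Prog.ofCode := Primrec.encode_iff.1 Prog.primrec_norm

/-! ### Rational arithmetic -/

theorem primrec_num : Primrec NNRat.num :=
  (Primrec.fst.comp (Primrec.unpair.comp primrec_ratCode)).of_eq fun q => by simp [ratCode]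

theorem primrec_den : Primrec NNRat.den :=
  (Primrec.succ.comp (Primrec.snd.comp (Primrec.unpair.comp primrec_ratCode))).of_eq fun q => by
    simp [ratCode, Nat.sub_add_cancel q.den_pos]

theorem primrec_natDiv : Primrec₂ fun a b : ℕ => (a : ℚ≥0) / ((b + 1 : ℕ) : ℚ≥0) :=
  (primrec_ratOfCode.comp Primrec₂.natPair).of_eq fun x => by simp [ratOfCode]

/-- A rational function of two arguments given on numerators and denominators. -/
theorem primrec_ratOp {op : ℚ≥0 → ℚ≥0 → ℚ≥0} {N : (ℕ × ℕ) × ℕ × ℕ → ℕ} (hN : Primrec N)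
    (h : ∀ a b c d : ℕ, 0 < b → 0 < d →
      op (a / b) (c / d) = N ((a, b), c, d) / ((b * d : ℕ) : ℚ≥0)) : Primrec₂ op := by
  have hq : Primrec fun x : ℚ≥0 × ℚ≥0 => ((x.1.num, x.1.den), x.2.num, x.2.den) :=
    Primrec.pair
      (Primrec.pair (primrec_num.comp Primrec.fst) (primrec_den.comp Primrec.fst))
      (Primrec.pair (primrec_num.comp Primrec.snd) (primrec_den.comp Primrec.snd))
  refine (primrec_natDiv.comp (hN.comp hq) (Primrec.pred.comp (Primrec.nat_mul.comp
    (primrec_den.comp Primrec.fst) (primrec_den.comp Primrec.snd)))).of_eq fun x => ?_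
  have h' := h x.1.num x.1.den x.2.num x.2.den x.1.den_pos x.2.den_pos
  rw [NNRat.num_div_den, NNRat.num_div_den] at h'
  rw [h', Nat.pred_eq_sub_one, Nat.sub_add_cancel (Nat.mul_pos x.1.den_pos x.2.den_pos)]

section
variable {α : Type} [Primcodable α]

theorem primrec_crossLeft : Primrec fun x : (ℕ × ℕ) × ℕ × ℕ => x.1.1 * x.2.2 :=
  Primrec.nat_mul.comp (Primrec.fst.comp Primrec.fst) (Primrec.snd.comp Primrec.snd)

theorem primrec_crossRight : Primrec fun x : (ℕ × ℕ) × ℕ × ℕ => x.2.1 * x.1.2 :=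
  Primrec.nat_mul.comp (Primrec.fst.comp Primrec.snd) (Primrec.snd.comp Primrec.fst)

theorem primrec_ratAdd : Primrec₂ ((· + ·) : ℚ≥0 → ℚ≥0 → ℚ≥0) := by
  refine primrec_ratOp (Primrec.nat_add.comp primrec_crossLeft primrec_crossRight) ?_
  intro a b c d hb hd
  have hb' : (b : ℚ≥0) ≠ 0 := by exact_mod_cast hb.ne'
  have hd' : (d : ℚ≥0) ≠ 0 := by exact_mod_cast hd.ne'
  push_cast
  field_simp

theorem primrec_ratMul : Primrec₂ ((· * ·) : ℚ≥0 → ℚ≥0 → ℚ≥0) := by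
  refine primrec_ratOp (Primrec.nat_mul.comp (Primrec.fst.comp Primrec.fst)
    (Primrec.fst.comp Primrec.snd)) ?_
  intro a b c d hb hd
  push_cast
  rw [div_mul_div_comm]

theorem primrec_ratSub : Primrec₂ ((· - ·) : ℚ≥0 → ℚ≥0 → ℚ≥0) := by
  refine primrec_ratOp (Primrec.nat_sub.comp primrec_crossLeft primrec_crossRight) ?_
  intro a b c d hb hd
  have hb' : (b : ℚ≥0) ≠ 0 := by exact_mod_cast hb.ne'
  have hd' : (d : ℚ≥0) ≠ 0 := by exact_mod_cast hd.ne'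
  have h1 : (a : ℚ≥0) / b = (a * d : ℕ) / (b * d : ℕ) := by push_cast; field_simp
  have h2 : (c : ℚ≥0) / d = (c * b : ℕ) / (b * d : ℕ) := by push_cast; field_simp
  rw [h1, h2, Nat.cast_tsub, tsub_div]

theorem primrec_ratLt : PrimrecRel ((· < ·) : ℚ≥0 → ℚ≥0 → Prop) := by
  refine (Primrec.nat_lt.comp
    (Primrec.nat_mul.comp (primrec_num.comp Primrec.fst) (primrec_den.comp Primrec.snd))
    (Primrec.nat_mul.comp (primrec_num.comp Primrec.snd) (primrec_den.comp Primrec.fst))).of_eq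
    fun x => ?_
  change _ ↔ x.1 < x.2
  conv_rhs => rw [← NNRat.num_div_den x.1, ← NNRat.num_div_den x.2]
  rw [div_lt_div_iff₀ (by exact_mod_cast x.1.den_pos) (by exact_mod_cast x.2.den_pos)]
  exact_mod_cast Iff.rfl

theorem primrec_ratSum : Primrec (List.sum : List ℚ≥0 → ℚ≥0) :=
  (Primrec.list_foldr Primrec.id (Primrec.const 0)
    (primrec_ratAdd.comp₂ (Primrec.fst.comp₂ Primrec₂.right)
      (Primrec.snd.comp₂ Primrec₂.right))).of_eq fun _ => rfl

/-! ### Inputs -/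

theorem primrec_inputList : Primrec inputList :=
  Primrec.encode_iff.1 Primrec.encode

theorem primrec_inputOfList : Primrec inputOfList :=
  Primrec.encode_iff.1 ((Primrec.encode.comp primrec_inputNorm :
    Primrec fun l => Encodable.encode (inputList (inputOfList l))))

theorem val_eq_inputList (η : Input) (v : Var) :
    η.val v = ratOfCode ((inputList η).getD v 0) :=
  congrFun (congrArg Input.val (inputOfList_inputList η).symm) v

theorem primrec_val : Primrec₂ Input.val :=
  (primrec_ratOfCode.comp ((Primrec.list_getD 0).comp (primrec_inputList.comp Primrec.fst)
    Primrec.snd)).of_eq fun x => (val_eq_inputList x.1 x.2).symm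

theorem Input.ext_val {η ζ : Input} (h : η.val = ζ.val) : η = ζ := by
  cases η; cases ζ; simp_all

theorem primrec_update : Primrec fun x : Input × Var × ℚ≥0 => x.1.update x.2.1 x.2.2 := by
  have hl : Primrec fun x : Input × Var × ℚ≥0 =>
      -- This length covers both the old support and the updated variable; superfluous zeros at the
      -- end do no harm to `inputOfList`.
      (List.range ((inputList x.1).length + (x.2.1 + 1))).map fun u =>
        if u = x.2.1 then ratCode x.2.2 else (inputList x.1).getD u 0 := by
    refine Primrec.list_map (Primrec.list_range.comp (Primrec.nat_add.comp
      (Primrec.list_length.comp (primrec_inputList.comp Primrec.fst))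
      (Primrec.succ.comp (Primrec.fst.comp Primrec.snd)))) ?_
    refine Primrec.ite (Primrec.eq.comp Primrec.snd
        (Primrec.fst.comp (Primrec.snd.comp Primrec.fst)))
      (primrec_ratCode.comp (Primrec.snd.comp (Primrec.snd.comp Primrec.fst)))
      ((Primrec.list_getD 0).comp (primrec_inputList.comp (Primrec.fst.comp Primrec.fst))
        Primrec.snd)
  refine (primrec_inputOfList.comp hl).of_eq fun x => Input.ext_val (funext fun u => ?_)
  obtain ⟨η, v, q⟩ := x
  simp only [inputOfList, Input.val_update, List.getD, List.getElem?_map]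
  by_cases hu : u < (inputList η).length + (v + 1)
  · rw [List.getElem?_range hu]
    by_cases huv : u = v
    · subst huv; simp [ratOfCode_ratCode]
    · simp [huv, val_eq_inputList η u, List.getD]
  · have huv : u ≠ v := fun h => hu (by
      rw [h]; exact (Nat.lt_succ_self v).trans_le (Nat.le_add_left _ _))
    have hlen : (inputList η).length ≤ u :=
      (Nat.le_add_right _ _).trans (not_lt.1 hu)
    rw [List.getElem?_eq_none (by simpa using hu), Function.update_of_ne huv, val_eq_inputList η u]
    simp [List.getD, List.getElem?_eq_none hlen]

/-! ### Recursion over syntax trees -/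

/-- Recursion over tree codes with a parameter is primitive recursive. -/
theorem primrec_treeRec {σ : Type} [Primcodable σ] (s₀ : σ) {f : α → ℕ → σ}
    {G : (α × ℕ) × σ × σ → σ} (hG : Primrec G)
    (hf : ∀ a n, f a n = G ((a, n), if ntag n = 0 then s₀ else f a (nfst n),
      if ntag n = 0 then s₀ else f a (nsnd n))) : Primrec₂ f := by
  have len : Primrec fun x : α × List σ => x.2.length := Primrec.list_length.comp Primrec.snd
  have child : ∀ c : ℕ → ℕ, Primrec c → Primrec fun x : α × List σ =>
      if ntag x.2.length = 0 then s₀ else x.2.getD (c x.2.length) s₀ := fun c hc =>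
    Primrec.ite (Primrec.eq.comp (primrec_ntag.comp len) (Primrec.const 0)) (Primrec.const s₀)
      ((Primrec.list_getD s₀).comp Primrec.snd (hc.comp len))
  -- The list `l` holds the values at all smaller codes, so its length is the current code. Children
  -- of a node with nonzero tag have smaller codes; at tag 0 the default `s₀` replaces them.
  refine Primrec.nat_strong_rec _ (g := fun a l => some (G ((a, l.length),
      if ntag l.length = 0 then s₀ else l.getD (nfst l.length) s₀,
      if ntag l.length = 0 then s₀ else l.getD (nsnd l.length) s₀))) ?_ ?_
  · exact Primrec.option_some.comp (hG.comp (Primrec.pair (Primrec.pair Primrec.fst len)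
      (Primrec.pair (child _ primrec_nfst) (child _ primrec_nsnd))))
  · intro a n
    simp only [List.length_map, List.length_range]
    rw [hf a n]
    by_cases h : ntag n = 0
    · simp [h]
    · simp [h, List.getD, nfst_lt h, nsnd_lt h]

theorem primrec_tag_eq {σ : Type} [Primcodable σ] (k : ℕ) :
    PrimrecPred fun x : (α × ℕ) × σ × σ => ntag x.1.2 = k :=
  Primrec.eq.comp (primrec_ntag.comp (Primrec.snd.comp Primrec.fst)) (Primrec.const k)

/-- An expression as a difference of nonnegative rationals. -/
def AExp.evalPair (η : Input) : AExp → ℚ≥0 × ℚ≥0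
  | .const q => (q, 0)
  | .var v => (η.val v, 0)
  | .add e₁ e₂ =>
      ((e₁.evalPair η).1 + (e₂.evalPair η).1, (e₁.evalPair η).2 + (e₂.evalPair η).2)
  | .sub e₁ e₂ =>
      ((e₁.evalPair η).1 + (e₂.evalPair η).2, (e₁.evalPair η).2 + (e₂.evalPair η).1)
  | .mul e₁ e₂ =>
      ((e₁.evalPair η).1 * (e₂.evalPair η).1 + (e₁.evalPair η).2 * (e₂.evalPair η).2,
        (e₁.evalPair η).1 * (e₂.evalPair η).2 + (e₁.evalPair η).2 * (e₂.evalPair η).1)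

/-- Representing signed values by such pairs reduces evaluation to addition and multiplication in
`ℚ≥0`. -/
theorem AExp.eval_eq_evalPair (η : Input) (e : AExp) :
    e.eval η.val = ((e.evalPair η).1 : ℚ) - (e.evalPair η).2 := by
  induction e with
  | const q => simp [AExp.eval, AExp.evalPair]
  | var v => simp [AExp.eval, AExp.evalPair]
  | add _ _ h₁ h₂ => simp only [AExp.eval, AExp.evalPair, h₁, h₂]; push_cast; ring
  | sub _ _ h₁ h₂ => simp only [AExp.eval, AExp.evalPair, h₁, h₂]; push_cast; ring
  | mul _ _ h₁ h₂ => simp only [AExp.eval, AExp.evalPair, h₁, h₂]; push_cast; ring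

theorem AExp.primrec_evalPair : Primrec₂ AExp.evalPair := by
  have hη : Primrec fun x : (Input × ℕ) × (ℚ≥0 × ℚ≥0) × ℚ≥0 × ℚ≥0 => x.1.1 :=
    Primrec.fst.comp Primrec.fst
  have hl : Primrec fun x : (Input × ℕ) × (ℚ≥0 × ℚ≥0) × ℚ≥0 × ℚ≥0 => nlab x.1.2 :=
    primrec_nlab.comp (Primrec.snd.comp Primrec.fst)
  have a1 : Primrec fun x : (Input × ℕ) × (ℚ≥0 × ℚ≥0) × ℚ≥0 × ℚ≥0 => x.2.1.1 :=
    Primrec.fst.comp (Primrec.fst.comp Primrec.snd)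
  have a2 : Primrec fun x : (Input × ℕ) × (ℚ≥0 × ℚ≥0) × ℚ≥0 × ℚ≥0 => x.2.1.2 :=
    Primrec.snd.comp (Primrec.fst.comp Primrec.snd)
  have b1 : Primrec fun x : (Input × ℕ) × (ℚ≥0 × ℚ≥0) × ℚ≥0 × ℚ≥0 => x.2.2.1 :=
    Primrec.fst.comp (Primrec.snd.comp Primrec.snd)
  have b2 : Primrec fun x : (Input × ℕ) × (ℚ≥0 × ℚ≥0) × ℚ≥0 × ℚ≥0 => x.2.2.2 :=
    Primrec.snd.comp (Primrec.snd.comp Primrec.snd)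
  have key : Primrec₂ fun (η : Input) n => (AExp.ofCode n).evalPair η := by
    refine primrec_treeRec (0, 0) (G := fun x =>
      if ntag x.1.2 = 0 then (ratOfCode (nlab x.1.2), 0)
      else if ntag x.1.2 = 1 then (x.1.1.val (nlab x.1.2), 0)
      else if ntag x.1.2 = 2 then (x.2.1.1 + x.2.2.1, x.2.1.2 + x.2.2.2)
      else if ntag x.1.2 = 3 then (x.2.1.1 + x.2.2.2, x.2.1.2 + x.2.2.1)
      else (x.2.1.1 * x.2.2.1 + x.2.1.2 * x.2.2.2, x.2.1.1 * x.2.2.2 + x.2.1.2 * x.2.2.1)) ?_ ?_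
    · exact Primrec.ite (primrec_tag_eq 0) ((primrec_ratOfCode.comp hl).pair (Primrec.const 0))
        (Primrec.ite (primrec_tag_eq 1) ((primrec_val.comp hη hl).pair (Primrec.const 0))
          (Primrec.ite (primrec_tag_eq 2)
            ((primrec_ratAdd.comp a1 b1).pair (primrec_ratAdd.comp a2 b2))
            (Primrec.ite (primrec_tag_eq 3)
              ((primrec_ratAdd.comp a1 b2).pair (primrec_ratAdd.comp a2 b1))
              ((primrec_ratAdd.comp (primrec_ratMul.comp a1 b1) (primrec_ratMul.comp a2 b2)).pair
                (primrec_ratAdd.comp (primrec_ratMul.comp a1 b2)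
                  (primrec_ratMul.comp a2 b1))))))
    · intro η n
      rw [AExp.ofCode]
      by_cases h0 : ntag n = 0
      · simp [h0, AExp.evalPair]
      by_cases h1 : ntag n = 1
      · simp [h1, AExp.evalPair]
      by_cases h2 : ntag n = 2
      · simp [h2, AExp.evalPair]
      by_cases h3 : ntag n = 3
      · simp [h3, AExp.evalPair]
      simp [h0, h1, h2, h3, AExp.evalPair]
  exact (key.comp Primrec.fst (AExp.primrec_code.comp Primrec.snd)).of_eq fun x => by
    simp [AExp.ofCode_code]

/-- Truncated subtraction in `ℚ≥0` is exactly the cut-off at 0 in the assignment rule. -/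
theorem AExp.toNNRat_eval (η : Input) (e : AExp) :
    (max (e.eval η.val) 0).toNNRat = (e.evalPair η).1 - (e.evalPair η).2 := by
  rw [AExp.eval_eq_evalPair, ← NNRat.coe_inj, Rat.coe_toNNRat _ (le_max_right _ _)]
  rcases le_total (e.evalPair η).1 (e.evalPair η).2 with h | h
  · rw [tsub_eq_zero_of_le h, max_eq_right (sub_nonpos.2 (by exact_mod_cast h))]; rfl
  · rw [NNRat.coe_sub h, max_eq_left (sub_nonneg.2 (by exact_mod_cast h))]

theorem BExp.primrec_eval : Primrec₂ fun (η : Input) (b : BExp) => b.eval η.val := by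
  have hη : Primrec fun x : (Input × ℕ) × Bool × Bool => x.1.1 := Primrec.fst.comp Primrec.fst
  have hl : Primrec fun x : (Input × ℕ) × Bool × Bool => (nlab x.1.2).unpair :=
    Primrec.unpair.comp (primrec_nlab.comp (Primrec.snd.comp Primrec.fst))
  have he1 : Primrec fun x : (Input × ℕ) × Bool × Bool =>
      (AExp.ofCode (nlab x.1.2).unpair.1).evalPair x.1.1 :=
    AExp.primrec_evalPair.comp hη (AExp.primrec_ofCode.comp (Primrec.fst.comp hl))
  have he2 : Primrec fun x : (Input × ℕ) × Bool × Bool =>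
      (AExp.ofCode (nlab x.1.2).unpair.2).evalPair x.1.1 :=
    AExp.primrec_evalPair.comp hη (AExp.primrec_ofCode.comp (Primrec.snd.comp hl))
  -- The differences `a - b` and `c - d` are compared through the sums `a + d` and `c + b`, which
  -- avoids negative numbers.
  have hL := primrec_ratAdd.comp (Primrec.fst.comp he1) (Primrec.snd.comp he2)
  have hR := primrec_ratAdd.comp (Primrec.fst.comp he2) (Primrec.snd.comp he1)
  have key : Primrec₂ fun (η : Input) n => (BExp.ofCode n).eval η.val := by
    refine primrec_treeRec false (G := fun x =>
      if ntag x.1.2 = 0 then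
        decide (((AExp.ofCode (nlab x.1.2).unpair.1).evalPair x.1.1).1 +
            ((AExp.ofCode (nlab x.1.2).unpair.2).evalPair x.1.1).2 =
          ((AExp.ofCode (nlab x.1.2).unpair.2).evalPair x.1.1).1 +
            ((AExp.ofCode (nlab x.1.2).unpair.1).evalPair x.1.1).2)
      else if ntag x.1.2 = 1 then
        decide (((AExp.ofCode (nlab x.1.2).unpair.1).evalPair x.1.1).1 +
            ((AExp.ofCode (nlab x.1.2).unpair.2).evalPair x.1.1).2 <
          ((AExp.ofCode (nlab x.1.2).unpair.2).evalPair x.1.1).1 +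
            ((AExp.ofCode (nlab x.1.2).unpair.1).evalPair x.1.1).2)
      else if ntag x.1.2 = 2 then !x.2.1
      else x.2.1 && x.2.2) ?_ ?_
    · exact Primrec.ite (primrec_tag_eq 0) (PrimrecPred.decide (Primrec.eq.comp hL hR))
        (Primrec.ite (primrec_tag_eq 1) (PrimrecPred.decide (primrec_ratLt.comp hL hR))
          (Primrec.ite (primrec_tag_eq 2) (Primrec.not.comp (Primrec.fst.comp Primrec.snd))
            (Primrec.and.comp (Primrec.fst.comp Primrec.snd) (Primrec.snd.comp Primrec.snd))))
    · intro η n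
      rw [BExp.ofCode]
      by_cases h0 : ntag n = 0
      · simp only [h0, if_true, BExp.eval, AExp.eval_eq_evalPair, sub_eq_sub_iff_add_eq_add]
        norm_cast
      by_cases h1 : ntag n = 1
      · simp only [h1, if_true, one_ne_zero, if_false, BExp.eval, AExp.eval_eq_evalPair,
          sub_lt_sub_iff]
        norm_cast
      by_cases h2 : ntag n = 2
      · simp [h2, BExp.eval]
      simp [h0, h1, h2, BExp.eval]
  exact (key.comp Primrec.fst (BExp.primrec_code.comp Primrec.snd)).of_eq fun x => by
    simp [BExp.ofCode_code]
end
end PGCL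

/-! ### Primitive recursiveness of successors and of halting probabilities. -/

namespace PGCL

theorem primrec_pushStack : Primrec₂ pushStack :=
  Primrec.pair (Primrec.fst.comp Primrec.snd)
    (Primrec.pair
      (Primrec.pair (Primrec.fst.comp (Primrec.fst.comp (Primrec.snd.comp Primrec.snd)))
        (Primrec.list_append.comp
          (Primrec.snd.comp (Primrec.fst.comp (Primrec.snd.comp Primrec.snd))) Primrec.fst))
      (Primrec.snd.comp (Primrec.snd.comp Primrec.snd)))

theorem primrec_singleton {α : Type} [Primcodable α] : Primrec fun a : α => [a] :=
  Primrec.list_cons.comp Primrec.id (Primrec.const [])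

theorem primrec_detSucc {α : Type} [Primcodable α] {o : α → Option Prog} {η : α → Input}
    (ho : Primrec o) (hη : Primrec η) :
    Primrec fun a => [((1, (o a, []), η a) : ℚ≥0 × Config)] :=
  primrec_singleton.comp ((Primrec.const 1).pair ((ho.pair (Primrec.const [])).pair hη))

theorem Prog.primrec_loop : Primrec₂ Prog.loop :=
  (Prog.primrec_ofCode.comp (primrec_node (Primrec.const 3) (BExp.primrec_code.comp Primrec.fst)
    (Prog.primrec_code.comp Primrec.snd) (Primrec.const 0))).of_eq
    fun x => Prog.ofCode_code (.loop x.1 x.2)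

theorem Prog.primrec_seq : Primrec₂ Prog.seq :=
  (Prog.primrec_ofCode.comp (primrec_node (Primrec.const 1) (Primrec.const 0)
    (Prog.primrec_code.comp Primrec.fst) (Prog.primrec_code.comp Primrec.snd))).of_eq
    fun x => Prog.ofCode_code (.seq x.1 x.2)

theorem primrec_probOfCode : Primrec fun n => (probOfCode n).1 :=
  Primrec.encode_iff.1 primrec_probNorm

/-- The data from which the successors of a program are computed: the valuation, the code of the
program, and the successors of its parts. -/
abbrev SuccsData := (Input × ℕ) × List (ℚ≥0 × Config) × List (ℚ≥0 × Config)

theorem primrec_progSuccs : Primrec₂ progSuccs := by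
  have hη : Primrec fun x : SuccsData => x.1.1 := Primrec.fst.comp Primrec.fst
  have hl : Primrec fun x : SuccsData => nlab x.1.2 := primrec_nlab.comp (Primrec.snd.comp Primrec.fst)
  have hP : Primrec fun x : SuccsData => Prog.ofCode (nfst x.1.2) :=
    Prog.primrec_ofCode.comp (primrec_nfst.comp (Primrec.snd.comp Primrec.fst))
  have hQ : Primrec fun x : SuccsData => Prog.ofCode (nsnd x.1.2) :=
    Prog.primrec_ofCode.comp (primrec_nsnd.comp (Primrec.snd.comp Primrec.fst))
  have hp : Primrec fun x : SuccsData => (probOfCode (nlab x.1.2)).1 := primrec_probOfCode.comp hl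
  have hb : Primrec fun x : SuccsData => BExp.ofCode (nlab x.1.2) := BExp.primrec_ofCode.comp hl
  have he : Primrec fun x : SuccsData => (AExp.ofCode (nlab x.1.2).unpair.2).evalPair x.1.1 :=
    AExp.primrec_evalPair.comp hη
      (AExp.primrec_ofCode.comp (Primrec.snd.comp (Primrec.unpair.comp hl)))
  have hc : ∀ {q : SuccsData → ℚ≥0} {P : SuccsData → Prog}, Primrec q → Primrec P →
      Primrec fun x : SuccsData => ((q x, (some (P x), []), x.1.1) : ℚ≥0 × Config) := fun hq hP =>
    hq.pair (((Primrec.option_some.comp hP).pair (Primrec.const [])).pair hη)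
  have hs : Primrec fun x : SuccsData => ((AExp.ofCode (nlab x.1.2).unpair.2).evalPair x.1.1).1 -
      ((AExp.ofCode (nlab x.1.2).unpair.2).evalPair x.1.1).2 :=
    primrec_ratSub.comp (Primrec.fst.comp he) (Primrec.snd.comp he)
  have hu := primrec_update.comp (hη.pair ((Primrec.fst.comp (Primrec.unpair.comp hl)).pair hs))
  have g0 : Primrec fun x : SuccsData => [((1, (none, []), x.1.1.update (nlab x.1.2).unpair.1
      (((AExp.ofCode (nlab x.1.2).unpair.2).evalPair x.1.1).1 -
        ((AExp.ofCode (nlab x.1.2).unpair.2).evalPair x.1.1).2)) : ℚ≥0 × Config)] :=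
    primrec_detSucc (Primrec.const none) hu
  have g1 : Primrec fun x : SuccsData => x.2.1.map (pushStack [Prog.ofCode (nsnd x.1.2)]) :=
    Primrec.list_map (Primrec.fst.comp Primrec.snd)
      (primrec_pushStack.comp ((primrec_singleton.comp hQ).comp Primrec.fst) Primrec.snd)
  have g2 : Primrec fun x : SuccsData =>
      [(((probOfCode (nlab x.1.2)).1, (some (Prog.ofCode (nfst x.1.2)), []), x.1.1) :
          ℚ≥0 × Config),
        (1 - (probOfCode (nlab x.1.2)).1, (some (Prog.ofCode (nsnd x.1.2)), []), x.1.1)] :=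
    Primrec.list_cons.comp (hc hp hP)
      (primrec_singleton.comp (hc (primrec_ratSub.comp (Primrec.const 1) hp) hQ))
  have g3 : Primrec fun x : SuccsData => if (BExp.ofCode (nlab x.1.2)).eval x.1.1.val = true then
        [((1, (some (.seq (Prog.ofCode (nfst x.1.2))
          (.loop (BExp.ofCode (nlab x.1.2)) (Prog.ofCode (nfst x.1.2)))), []), x.1.1) :
            ℚ≥0 × Config)]
      else [(1, (none, []), x.1.1)] :=
    Primrec.ite (Primrec.eq.comp (BExp.primrec_eval.comp hη hb) (Primrec.const true))
      (primrec_detSucc (Primrec.option_some.comp (Prog.primrec_seq.comp hP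
        (Prog.primrec_loop.comp hb hP))) hη)
      (primrec_detSucc (Primrec.const none) hη)
  -- The recursion uses earlier values only at a concatenation, where the successors come from the
  -- first part; at choices and loops the children are merely decoded as programs.
  have key : Primrec₂ fun (η : Input) n => progSuccs η (Prog.ofCode n) := by
    refine primrec_treeRec [] (Primrec.ite (primrec_tag_eq 0) g0
      (Primrec.ite (primrec_tag_eq 1) g1 (Primrec.ite (primrec_tag_eq 2) g2 g3))) ?_
    · intro η n
      rw [Prog.ofCode]
      by_cases h0 : ntag n = 0
      · simp [h0, progSuccs, AExp.toNNRat_eval]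
      by_cases h1 : ntag n = 1
      · simp [h1, progSuccs]
      by_cases h2 : ntag n = 2
      · simp [h2, progSuccs]
      simp [h0, h1, h2, progSuccs]
  exact (key.comp Primrec.fst (Prog.primrec_code.comp Primrec.snd)).of_eq fun x => by
    simp [Prog.ofCode_code]

theorem primrec_succs : Primrec succs := by
  have hη : Primrec fun c : Config => c.2 := Primrec.snd
  have hK : Primrec fun c : Config => c.1.2 := Primrec.snd.comp Primrec.fst
  have hnone : Primrec fun c : Config => (List.casesOn c.1.2 []
      fun Q K => [(1, (some Q, K), c.2)] : List (ℚ≥0 × Config)) :=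
    Primrec.list_casesOn hK (Primrec.const []) (h := fun c x => [(1, (some x.1, x.2), c.2)])
      (primrec_singleton.comp ((Primrec.const 1).pair
        (((Primrec.option_some.comp (Primrec.fst.comp Primrec.snd)).pair
          (Primrec.snd.comp Primrec.snd)).pair (hη.comp Primrec.fst))))
  refine (Primrec.option_casesOn (Primrec.fst.comp Primrec.fst) hnone
    (g := fun c P => (progSuccs c.2 P).map (pushStack c.1.2)) ?_).of_eq ?_
  · exact Primrec.list_map (primrec_progSuccs.comp (hη.comp Primrec.fst) Primrec.snd)
      (primrec_pushStack.comp₂ ((hK.comp Primrec.fst).comp₂ Primrec₂.left) Primrec₂.right)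
  · rintro ⟨⟨_ | P, _ | ⟨Q, K⟩⟩, η⟩ <;> rfl

theorem primrec_halted : Primrec halted := by
  classical
  have h : PrimrecPred fun c : Config => c.1 = (none, []) :=
    Primrec.eq.comp Primrec.fst (Primrec.const _)
  refine (Primrec.ite h (Primrec.const true) (Primrec.const false)).of_eq fun c => ?_
  split
  · next h => exact (halted_iff.2 h).symm
  · next h => exact (Bool.eq_false_iff.2 (halted_iff.not.2 h)).symm

/-- One step of a finite distribution over configurations. -/
def spread (L : List (ℚ≥0 × Config)) : List (ℚ≥0 × Config) :=
  L.flatMap fun r => (succs r.2).map fun s => (r.1 * s.1, s.2)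

theorem primrec_spread : Primrec spread := by
  refine Primrec.list_flatMap Primrec.id ?_
  refine Primrec.list_map (primrec_succs.comp (Primrec.snd.comp Primrec.snd)) ?_
  exact (primrec_ratMul.comp (Primrec.fst.comp (Primrec.snd.comp Primrec.fst))
    (Primrec.fst.comp Primrec.snd)).pair (Primrec.snd.comp Primrec.snd)

/-- The defining recursion of `haltProb`, extended linearly to finite distributions. -/
theorem sum_haltProb_spread (k : ℕ) (L : List (ℚ≥0 × Config)) :
    ((spread L).map fun r => r.1 * haltProb k r.2).sum =
      (L.map fun r => r.1 * haltProb (k + 1) r.2).sum := by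
  induction L with
  | nil => rfl
  | cons r L ih =>
    have h : spread (r :: L) = ((succs r.2).map fun s => (r.1 * s.1, s.2)) ++ spread L := rfl
    rw [h, List.map_append, List.sum_append, ih, List.map_cons, List.sum_cons, haltProb,
      List.map_map, ← List.sum_map_mul_left]
    simp only [Function.comp_def, mul_assoc]

/-- The recursion for `haltProb` changes its configuration argument and branches. Pushing the whole
distribution forward turns it into the iteration of a single primitive recursive map. -/
theorem haltProb_eq_spread (k : ℕ) (c : Config) :
    haltProb k c = ((spread^[k] [(1, c)]).map fun r => if halted r.2 then r.1 else 0).sum := by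
  have h : ∀ (k : ℕ) (L : List (ℚ≥0 × Config)),
      (L.map fun r => r.1 * haltProb k r.2).sum =
        ((spread^[k] L).map fun r => if halted r.2 then r.1 else 0).sum := by
    intro k
    induction k with
    | zero => intro L; simp [haltProb]
    | succ k ih => intro L; rw [Function.iterate_succ_apply, ← ih, sum_haltProb_spread]
  simpa using h k [(1, c)]

theorem primrec_haltProb : Primrec₂ haltProb := by
  refine Primrec.of_eq ?_ fun x : ℕ × Config => (haltProb_eq_spread x.1 x.2).symm
  refine primrec_ratSum.comp (Primrec.list_map ?_ ?_)
  · exact Primrec.nat_iterate Primrec.fst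
      (primrec_singleton.comp ((Primrec.const 1).pair Primrec.snd))
      (primrec_spread.comp₂ Primrec₂.right)
  · exact Primrec.ite (Primrec.eq.comp (primrec_halted.comp (Primrec.snd.comp Primrec.snd))
      (Primrec.const true)) (Primrec.fst.comp Primrec.snd) (Primrec.const 0)

/-! ## Membership in `Π₂⁰` -/

theorem primrec_sum_haltProb :
    Primrec₂ fun (c : Config) (n : ℕ) => ∑ k ∈ Finset.range n, haltProb k c := by
  refine Primrec.of_eq (f := fun x : Config × ℕ =>
    ((List.range x.2).map fun k => haltProb k x.1).sum) ?_ fun x => rfl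
  exact primrec_ratSum.comp (Primrec.list_map (Primrec.list_range.comp Primrec.snd)
    (primrec_haltProb.comp Primrec.snd (Primrec.fst.comp Primrec.fst)))

/-- Since the total is at most 1, it is 1 as soon as the partial sums exceed numbers arbitrarily
close to 1; the bounds `m / (m + 1)` are rational, so each comparison is decidable. -/
theorem haltTotal_eq_one_iff (c : Config) : haltTotal c = 1 ↔
    ∀ m : ℕ, ∃ n : ℕ, (m : ℚ≥0) / ((m + 1 : ℕ) : ℚ≥0) < ∑ k ∈ Finset.range n, haltProb k c := by
  have hcoe : ∀ n, ((∑ k ∈ Finset.range n, haltProb k c : ℚ≥0) : ℝ≥0) =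
      ∑ k ∈ Finset.range n, (haltProb k c : ℝ≥0) := fun n => NNRat.cast_sum _ _
  constructor
  · intro h m
    have hm : (((m : ℚ≥0) / ((m + 1 : ℕ) : ℚ≥0) : ℚ≥0) : ℝ≥0) < 1 := by
      have : (m : ℚ≥0) / ((m + 1 : ℕ) : ℚ≥0) < 1 := by
        rw [div_lt_one (by positivity)]; exact_mod_cast Nat.lt_succ_self m
      exact_mod_cast this
    have hm' : ((((m : ℚ≥0) / ((m + 1 : ℕ) : ℚ≥0) : ℚ≥0) : ℝ≥0) : ℝ≥0∞) < haltTotal c := by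
      rw [h]; exact_mod_cast hm
    rw [haltTotal, ENNReal.tsum_eq_iSup_nat, lt_iSup_iff] at hm'
    obtain ⟨n, hn⟩ := hm'
    refine ⟨n, ?_⟩
    rw [← ENNReal.ofNNReal_finsetSum, ← hcoe, ENNReal.coe_lt_coe] at hn
    exact_mod_cast hn
  · intro h
    refine le_antisymm (haltTotal_le_one c) (le_of_forall_lt fun a ha => ?_)
    lift a to ℝ≥0 using ha.ne_top
    have ha' : (a : ℝ) < 1 := by exact_mod_cast ha
    -- From `1 / (m + 1) < 1 - a` it follows that `a < m / (m + 1)`.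
    obtain ⟨m, hm⟩ := exists_nat_one_div_lt (sub_pos.2 ha')
    obtain ⟨n, hn⟩ := h m
    have h1 : a < (((m : ℚ≥0) / ((m + 1 : ℕ) : ℚ≥0) : ℚ≥0) : ℝ≥0) := by
      rw [← NNReal.coe_lt_coe]
      push_cast
      have : (m : ℝ) / (m + 1) = 1 - 1 / (m + 1) := by field_simp; ring
      linarith
    have h2 : (((m : ℚ≥0) / ((m + 1 : ℕ) : ℚ≥0) : ℚ≥0) : ℝ≥0) <
        ∑ k ∈ Finset.range n, (haltProb k c : ℝ≥0) := by
      rw [← hcoe]; exact_mod_cast hn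
    calc (a : ℝ≥0∞) < ((∑ k ∈ Finset.range n, (haltProb k c : ℝ≥0) : ℝ≥0) : ℝ≥0∞) := by
          exact_mod_cast h1.trans h2
      _ = ∑ k ∈ Finset.range n, ((haltProb k c : ℝ≥0) : ℝ≥0∞) := by push_cast; rfl
      _ ≤ haltTotal c := ENNReal.sum_le_tsum _

theorem isPi2_AST : IsPi2 AST := by
  refine ⟨fun x => (x.2.1 : ℚ≥0) / ((x.2.1 + 1 : ℕ) : ℚ≥0) <
    ∑ k ∈ Finset.range x.2.2, haltProb k (initConfig x.1.1 x.1.2), ?_, fun x => ?_⟩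
  · refine PrimrecPred.computablePred (primrec_ratLt.comp
      (primrec_natDiv.comp (Primrec.fst.comp Primrec.snd) (Primrec.fst.comp Primrec.snd))
      (primrec_sum_haltProb.comp ?_ (Primrec.snd.comp Primrec.snd)))
    exact ((Primrec.option_some.comp (Primrec.fst.comp Primrec.fst)).pair
      (Primrec.const [])).pair (Primrec.snd.comp Primrec.fst)
  · change _ ↔ ∀ m : ℕ, ∃ n : ℕ, (m : ℚ≥0) / ((m + 1 : ℕ) : ℚ≥0) <
      ∑ k ∈ Finset.range n, haltProb k (initConfig x.1 x.2)
    rw [← haltTotal_eq_one_iff, ← prTerm_eq_haltTotal]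
    rfl

end PGCL

namespace PGCL

/-! ## Deterministic runs -/

/-- `c` reaches `d` in exactly `n` steps, none of which is a probabilistic choice. -/
def Runs : ℕ → Config → Config → Prop
  | 0, c, d => c = d
  | n + 1, c, d => ∃ c', succs c = [(1, c')] ∧ Runs n c' d

theorem Runs.trans {m n : ℕ} {c d e : Config} (h₁ : Runs m c d) (h₂ : Runs n d e) :
    Runs (m + n) c e := by
  induction m generalizing c with
  | zero => obtain rfl : c = d := h₁; simpa using h₂
  | succ m ih =>
    obtain ⟨c', hc, h⟩ := h₁
    rw [Nat.succ_add]
    exact ⟨c', hc, ih h⟩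

theorem Runs.single {c d : Config} (h : succs c = [(1, d)]) : Runs 1 c d := ⟨d, h, rfl⟩

/-! ### Halting probabilities along deterministic runs. -/

theorem haltProb_zero_of_succs_ne_nil {c : Config} (h : succs c ≠ []) : haltProb 0 c = 0 := by
  rcases succs_cases c with ⟨h', -⟩ | ⟨h', -⟩
  · exact absurd h' h
  · simp [haltProb, halted_iff.not.2 h']

theorem haltTotal_eq_add (c : Config) : haltTotal c =
    ((haltProb 0 c : ℝ≥0) : ℝ≥0∞) + ∑' k, ((haltProb (k + 1) c : ℝ≥0) : ℝ≥0∞) :=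
  tsum_eq_zero_add' ENNReal.summable

theorem haltTotal_of_succs_singleton {c d : Config} (h : succs c = [(1, d)]) :
    haltTotal c = haltTotal d := by
  rw [haltTotal_eq_add, haltProb_zero_of_succs_ne_nil (by simp [h])]
  simp [haltProb, h, haltTotal]

theorem haltTotal_of_succs_pair {c d d' : Config} {p q : ℚ≥0} (h : succs c = [(p, d), (q, d')]) :
    haltTotal c = ((p : ℝ≥0) : ℝ≥0∞) * haltTotal d + ((q : ℝ≥0) : ℝ≥0∞) * haltTotal d' := by
  rw [haltTotal_eq_add, haltProb_zero_of_succs_ne_nil (by simp [h])]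
  simp [haltProb, h, haltTotal, ENNReal.tsum_add, ENNReal.tsum_mul_left]

theorem Runs.haltTotal_eq {n : ℕ} {c d : Config} (h : Runs n c d) :
    haltTotal c = haltTotal d := by
  induction n generalizing c with
  | zero => exact congrArg _ h
  | succ n ih =>
    obtain ⟨c', hc, h⟩ := h
    rw [haltTotal_of_succs_singleton hc, ih h]

theorem Runs.haltProb_add {n : ℕ} {c d : Config} (h : Runs n c d) (k : ℕ) :
    haltProb (n + k) c = haltProb k d := by
  induction n generalizing c with
  | zero => obtain rfl : c = d := h; rw [Nat.zero_add]
  | succ n ih =>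
    obtain ⟨c', hc, h⟩ := h
    rw [Nat.succ_add, haltProb, hc]
    simpa using ih h

theorem Runs.haltProb_of_lt {n : ℕ} {c d : Config} (h : Runs n c d) {k : ℕ} (hk : k < n) :
    haltProb k c = 0 := by
  induction n generalizing c k with
  | zero => omega
  | succ n ih =>
    obtain ⟨c', hc, h⟩ := h
    cases k with
    | zero => exact haltProb_zero_of_succs_ne_nil (by simp [hc])
    | succ k => simpa [haltProb, hc] using ih h (Nat.lt_of_succ_lt_succ hk)

/-- A configuration that keeps running deterministically never halts. -/
theorem haltTotal_eq_zero (S : Set Config)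
    (hS : ∀ c ∈ S, ∃ n, ∃ d ∈ S, Runs (n + 1) c d) {c : Config} (hc : c ∈ S) :
    haltTotal c = 0 := by
  have : ∀ k, ∀ c ∈ S, haltProb k c = 0 := by
    intro k
    induction k using Nat.strong_induction_on with
    | _ k ih =>
      intro c hc
      obtain ⟨n, d, hd, h⟩ := hS c hc
      by_cases hk : k < n + 1
      · exact h.haltProb_of_lt hk
      · obtain ⟨j, rfl⟩ := Nat.exists_eq_add_of_le (not_lt.1 hk)
        rw [h.haltProb_add]
        exact ih j (by omega) d hd
  simp [haltTotal, this _ c hc]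

/-! ### Rules for proving deterministic termination. -/

/-- `P` runs deterministically from `η` to termination in `η'`. -/
def Exec (P : Prog) (η η' : Input) : Prop :=
  ∃ n, ∀ K, Runs (n + 1) ((some P, K), η) ((none, K), η')

theorem exec_of_progSuccs {P : Prog} {η η' : Input} (h : progSuccs η P = [(1, (none, []), η')]) :
    Exec P η η' :=
  ⟨0, fun K => Runs.single (by simp [succs, h, pushStack])⟩

theorem succs_seq (P Q : Prog) (K : List Prog) (η : Input) :
    succs ((some (.seq P Q), K), η) = succs ((some P, Q :: K), η) := by
  simp [succs, progSuccs, pushStack_pushStack]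

/-- The two starting configurations differ but have the same successors, so a run can be transferred
only if it has at least one step. This is why `Exec` counts `n + 1` steps. -/
theorem runs_seq {P Q : Prog} {K : List Prog} {η : Input} {n : ℕ} {d : Config}
    (h : Runs (n + 1) ((some P, Q :: K), η) d) : Runs (n + 1) ((some (.seq P Q), K), η) d := by
  obtain ⟨c, hc, h⟩ := h
  exact ⟨c, (succs_seq P Q K η).trans hc, h⟩

/-- The first part of a concatenation runs, and the second is started. -/
theorem Exec.runs_seq {P Q : Prog} {η η' : Input} (h : Exec P η η') :
    ∃ n, ∀ K, Runs (n + 1) ((some (.seq P Q), K), η) ((some Q, K), η') := by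
  obtain ⟨n, h⟩ := h
  exact ⟨n + 1, fun K => (PGCL.runs_seq (h (Q :: K))).trans (Runs.single rfl)⟩

theorem Exec.seq {P Q : Prog} {η η' η'' : Input} (h₁ : Exec P η η') (h₂ : Exec Q η' η'') :
    Exec (.seq P Q) η η'' := by
  obtain ⟨m, hm⟩ := h₁.runs_seq
  obtain ⟨n, hn⟩ := h₂
  exact ⟨m + 1 + n, fun K => (hm K).trans (hn K)⟩

theorem exec_loop_of_false {b : BExp} {P : Prog} {η : Input} (h : b.eval η.val = false) :
    Exec (.loop b P) η η :=
  exec_of_progSuccs (by simp [progSuccs, h])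

theorem succs_loop_of_true {b : BExp} {P : Prog} {K : List Prog} {η : Input}
    (h : b.eval η.val = true) :
    succs ((some (.loop b P), K), η) = [(1, (some (.seq P (.loop b P)), K), η)] := by
  simp [succs, progSuccs, h, pushStack]

theorem exec_loop_of_true {b : BExp} {P : Prog} {η η' η'' : Input} (h : b.eval η.val = true)
    (h₁ : Exec P η η') (h₂ : Exec (.loop b P) η' η'') : Exec (.loop b P) η η'' := by
  obtain ⟨n, hn⟩ := h₁.seq h₂
  exact ⟨1 + n, fun K => (Runs.single (succs_loop_of_true h)).trans (hn K)⟩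

/-- `P` runs deterministically from `η` to termination with postcondition `R`. -/
def Reaches (P : Prog) (η : Input) (R : Input → Prop) : Prop := ∃ η', Exec P η η' ∧ R η'

theorem Reaches.mono {P : Prog} {η : Input} {R R' : Input → Prop} (h : Reaches P η R)
    (hR : ∀ η', R η' → R' η') : Reaches P η R' :=
  h.imp fun η' h => ⟨h.1, hR η' h.2⟩

theorem reaches_seq {P Q : Prog} {η : Input} {R : Input → Prop}
    (h : Reaches P η fun η' => Reaches Q η' R) : Reaches (.seq P Q) η R := by
  obtain ⟨η', h₁, η'', h₂, hR⟩ := h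
  exact ⟨η'', h₁.seq h₂, hR⟩

/-- The cut-off at 0 makes assignments perform truncated subtraction of natural numbers, which
replaces the missing conditional in the programs below. -/
theorem reaches_assign_sub {v : Var} {e : AExp} {η : Input} {R : Input → Prop} (m n : ℕ)
    (h : e.eval η.val = (m : ℚ) - n) (hR : R (η.update v ((m - n : ℕ) : ℚ≥0))) :
    Reaches (.assign v e) η R := by
  refine ⟨_, exec_of_progSuccs rfl, ?_⟩
  convert hR using 2
  rw [h, ← NNRat.coe_inj, Rat.coe_toNNRat _ (le_max_right _ _), NNRat.coe_natCast]
  rcases le_total m n with hmn | hmn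
  · rw [Nat.sub_eq_zero_of_le hmn, max_eq_right (sub_nonpos.2 (by exact_mod_cast hmn))]; simp
  · rw [Nat.cast_sub hmn, max_eq_left (sub_nonneg.2 (by exact_mod_cast hmn))]

theorem reaches_assign {v : Var} {e : AExp} {η : Input} {R : Input → Prop} (m : ℕ)
    (h : e.eval η.val = (m : ℚ)) (hR : R (η.update v (m : ℚ≥0))) :
    Reaches (.assign v e) η R :=
  reaches_assign_sub m 0 (by simpa using h) (by simpa using hR)

/-- The rule for loops, with an invariant indexed by the number of remaining iterations. -/
theorem reaches_loop {b : BExp} {P : Prog} {R : Input → Prop} (I : ℕ → Input → Prop)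
    (h₀ : ∀ η, I 0 η → b.eval η.val = false ∧ R η)
    (h₁ : ∀ k η, I (k + 1) η → b.eval η.val = true ∧ Reaches P η (I k)) {k : ℕ} {η : Input}
    (h : I k η) : Reaches (.loop b P) η R := by
  induction k generalizing η with
  | zero => exact ⟨η, exec_loop_of_false (h₀ η h).1, (h₀ η h).2⟩
  | succ k ih =>
    obtain ⟨hb, η', hP, hI⟩ := h₁ k η h
    obtain ⟨η'', hL, hR⟩ := ih hI
    exact ⟨η'', exec_loop_of_true hb hP hL, hR⟩

/-! ## Programs for the primitive recursive functions -/

theorem Input.val_update_of_ne (η : Input) {v u : ℕ} (h : u ≠ v) (q : ℚ≥0) :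
    (η.update v q).val u = η.val u :=
  Function.update_of_ne h _ _

theorem Input.update_update (η : Input) (v : Var) (q r : ℚ≥0) :
    (η.update v q).update v r = η.update v r :=
  Input.ext_val (by simp)

/-- `d := ⟨a, b⟩`. -/
def pairProg (d a b : Var) : Prog :=
  -- After two assignments `d` is `1 ∸ (b ∸ a)`, which is 0 if `a < b` and 1 otherwise; it selects
  -- between the two branches `b * b + a` and `a * a + a + b` of `Nat.pair`.
  .seq (.assign d (.sub (.var b) (.var a)))
    (.seq (.assign d (.sub (.const 1) (.var d)))
      (.assign d (.add
        (.mul (.sub (.const 1) (.var d)) (.add (.mul (.var b) (.var b)) (.var a)))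
        (.mul (.var d) (.add (.add (.mul (.var a) (.var a)) (.var a)) (.var b))))))

theorem reaches_pairProg {d a b : Var} (ha : a ≠ d) (hb : b ≠ d) {η : Input} {m n : ℕ}
    (hm : η.val a = m) (hn : η.val b = n) {R : Input → Prop}
    (hR : R (η.update d (Nat.pair m n : ℕ))) : Reaches (pairProg d a b) η R := by
  refine reaches_seq (reaches_assign_sub n m (by simp [AExp.eval, hm, hn]) ?_)
  refine reaches_seq (reaches_assign_sub 1 (n - m) (by simp [AExp.eval, -Nat.cast_tsub]) ?_)
  refine reaches_assign (Nat.pair m n) ?_ (by simpa only [Input.update_update] using hR)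
  simp only [AExp.eval, Input.val_update, Function.update_self, Function.update_of_ne ha,
    Function.update_of_ne hb, hm, hn, Nat.pair]
  by_cases h : m < n
  · rw [Nat.sub_eq_zero_of_le (show 1 ≤ n - m by omega)]
    simp [h]
  · rw [Nat.sub_eq_zero_of_le (show n ≤ m by omega)]
    simp [h]

/-- `s := ⌊√n⌋`. -/
def sqrtProg (s n : Var) : Prog :=
  .seq (.assign s (.const 0))
    (.loop (.not (.lt (.var n)
        (.mul (.add (.var s) (.const 1)) (.add (.var s) (.const 1)))))
      (.assign s (.add (.var s) (.const 1))))

theorem reaches_sqrtProg {s v : Var} (hv : v ≠ s) {η : Input} {n : ℕ} (hn : η.val v = n)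
    {R : Input → Prop} (hR : R (η.update s (Nat.sqrt n : ℕ))) : Reaches (sqrtProg s v) η R := by
  refine reaches_seq (reaches_assign 0 (by simp [AExp.eval]) ?_)
  have hb : ∀ r : ℕ, BExp.eval (η.update s r).val (.not (.lt (.var v)
      (.mul (.add (.var s) (.const 1)) (.add (.var s) (.const 1))))) =
        decide ((r + 1) * (r + 1) ≤ n) := by
    intro r
    simp only [BExp.eval, AExp.eval, Input.val_update, Function.update_self,
      Function.update_of_ne hv, hn, ← decide_not, not_lt]
    congr 1
    push_cast
    norm_cast
  -- The guard says `(r + 1)² ≤ n`, so exactly `√n - r` iterations remain when `s` holds `r`.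
  refine reaches_loop (fun k ζ => ∃ r : ℕ, r + k = n.sqrt ∧ ζ = η.update s r) ?_ ?_
    (k := n.sqrt) ⟨0, by simp, rfl⟩
  · rintro ζ ⟨r, hr, rfl⟩
    obtain rfl : r = n.sqrt := hr
    refine ⟨?_, hR⟩
    rw [hb, decide_eq_false_iff_not, not_le]
    exact Nat.lt_succ_sqrt n
  · rintro k ζ ⟨r, hr, rfl⟩
    refine ⟨?_, reaches_assign (r + 1) (by simp [AExp.eval]) ⟨r + 1, by omega, ?_⟩⟩
    · rw [hb, decide_eq_true_iff]
      exact Nat.le_sqrt.1 (by omega)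
    · rw [Input.update_update]

/-- `P` computes `f` on the variable `i`, changing no smaller variable. -/
def ComputesAt (i : ℕ) (P : Prog) (f : ℕ → ℕ) : Prop :=
  ∀ (η : Input) (n : ℕ), η.val i = n →
    Reaches P η fun η' => η'.val i = f n ∧ ∀ j : ℕ, j < i → η'.val j = η.val j

/-- With `s = ⌊√n⌋` and `d = n - s²`, the first component is `min d s = d ∸ (d ∸ s)`. -/
theorem exists_computesAt_left (i : ℕ) : ∃ P, ComputesAt i P fun n => n.unpair.1 := by
  refine ⟨.seq (sqrtProg (i + 1) i)
    (.seq (.assign (i + 2) (.sub (.var i) (.mul (.var (i + 1)) (.var (i + 1)))))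
      (.seq (.assign (i + 3) (.sub (.var (i + 2)) (.var (i + 1))))
        (.assign i (.sub (.var (i + 2)) (.var (i + 3)))))), fun η n hn => ?_⟩
  refine reaches_seq (reaches_sqrtProg (by simp) hn ?_)
  refine reaches_seq (reaches_assign_sub n (n.sqrt * n.sqrt) ?_ ?_)
  · simp [AExp.eval, hn]
  refine reaches_seq (reaches_assign_sub (n - n.sqrt * n.sqrt) n.sqrt ?_ ?_)
  · simp [AExp.eval, -Nat.cast_tsub]
  refine reaches_assign_sub (n - n.sqrt * n.sqrt) (n - n.sqrt * n.sqrt - n.sqrt) ?_ ⟨?_, ?_⟩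
  · simp [AExp.eval, -Nat.cast_tsub]
  · simp only [Input.val_update, Function.update_self, Nat.unpair]
    congr 1
    split <;> simp only <;> omega
  · intro j hj
    simp [show j ≠ i by omega, show j ≠ i + 1 by omega,
      show j ≠ i + 2 by omega, show j ≠ i + 3 by omega]

/-- With the same `s` and `d`, the second component is `s` if `d < s` and `d - s` otherwise; the
selector is `1 ∸ (s ∸ d)`. A negative `d - s` is harmless, as it is multiplied by 0. -/
theorem exists_computesAt_right (i : ℕ) : ∃ P, ComputesAt i P fun n => n.unpair.2 := by
  refine ⟨.seq (sqrtProg (i + 1) i)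
    (.seq (.assign (i + 2) (.sub (.var i) (.mul (.var (i + 1)) (.var (i + 1)))))
      (.seq (.assign (i + 3) (.sub (.var (i + 1)) (.var (i + 2))))
        (.seq (.assign (i + 3) (.sub (.const 1) (.var (i + 3))))
          (.assign i (.add (.mul (.sub (.const 1) (.var (i + 3))) (.var (i + 1)))
            (.mul (.var (i + 3)) (.sub (.var (i + 2)) (.var (i + 1))))))))), fun η n hn => ?_⟩
  refine reaches_seq (reaches_sqrtProg (by simp) hn ?_)
  refine reaches_seq (reaches_assign_sub n (n.sqrt * n.sqrt) ?_ ?_)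
  · simp [AExp.eval, hn]
  refine reaches_seq (reaches_assign_sub n.sqrt (n - n.sqrt * n.sqrt) ?_ ?_)
  · simp [AExp.eval, -Nat.cast_tsub]
  refine reaches_seq (reaches_assign_sub 1 (n.sqrt - (n - n.sqrt * n.sqrt)) ?_ ?_)
  · simp [AExp.eval, -Nat.cast_tsub]
  refine reaches_assign n.unpair.2 ?_ ⟨?_, ?_⟩
  · simp only [AExp.eval, Input.val_update, Function.update_apply, Nat.unpair]
    generalize n - n.sqrt * n.sqrt = d
    generalize n.sqrt = s
    by_cases h : d < s
    · rw [Nat.sub_eq_zero_of_le (show 1 ≤ s - d by omega)]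
      simp [h]
    · rw [Nat.sub_eq_zero_of_le (show s ≤ d by omega)]
      simp [h, Nat.cast_sub (not_lt.1 h)]
  · simp
  · intro j hj
    simp [show j ≠ i by omega, show j ≠ i + 1 by omega,
      show j ≠ i + 2 by omega, show j ≠ i + 3 by omega]

/-- Running the two programs at `i + 1` and `i + 2` protects the argument in `i` from both, and the
first result from the second program. -/
theorem exists_computesAt_pair {f g : ℕ → ℕ} (hf : ∀ i, ∃ P, ComputesAt i P f)
    (hg : ∀ i, ∃ P, ComputesAt i P g) (i : ℕ) :
    ∃ P, ComputesAt i P fun n => Nat.pair (f n) (g n) := by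
  obtain ⟨F, hF⟩ := hf (i + 1)
  obtain ⟨G, hG⟩ := hg (i + 2)
  refine ⟨.seq (.assign (i + 1) (.var i)) (.seq F (.seq (.assign (i + 2) (.var i))
    (.seq G (pairProg i (i + 1) (i + 2))))), fun η n hn => ?_⟩
  refine reaches_seq (reaches_assign n (by simp [AExp.eval, hn]) ?_)
  refine reaches_seq ((hF _ n (by simp)).mono fun η₁ ⟨h₁, h₁'⟩ => ?_)
  have hi₁ : η₁.val i = n := by rw [h₁' i (by omega)]; simp [hn]
  refine reaches_seq (reaches_assign n (by simp [AExp.eval, hi₁]) ?_)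
  refine reaches_seq ((hG _ n (by simp)).mono fun η₂ ⟨h₂, h₂'⟩ => ?_)
  have hi₂ : η₂.val (i + 1) = f n := by rw [h₂' (i + 1) (by omega)]; simp [h₁]
  refine reaches_pairProg (by simp) (by simp) hi₂ h₂ ⟨by simp, fun j hj => ?_⟩
  have e₂ := h₂' j (by omega)
  have e₁ := h₁' j (by omega)
  rw [Input.val_update_of_ne _ (by omega)] at e₁ e₂ ⊢
  rw [e₂, e₁]

theorem exists_computesAt_prec {f g : ℕ → ℕ} (hf : ∀ i, ∃ P, ComputesAt i P f)
    (hg : ∀ i, ∃ P, ComputesAt i P g) (i : ℕ) :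
    ∃ P, ComputesAt i P (Nat.unpaired fun z n =>
      n.rec (f z) fun y IH => g (Nat.pair z (Nat.pair y IH))) := by
  obtain ⟨A, hA⟩ := exists_computesAt_left (i + 1)
  obtain ⟨B, hB⟩ := exists_computesAt_right (i + 2)
  obtain ⟨F, hF⟩ := hf (i + 4)
  obtain ⟨G, hG⟩ := hg (i + 4)
  -- Variable `i + 1` holds the parameter, `i + 2` the bound, `i + 3` the counter and `i + 4` the
  -- value reached so far; `i + 5` is scratch. The step program runs at `i + 4` and so preserves the
  -- first three.
  refine ⟨.seq (.assign (i + 1) (.var i)) (.seq A (.seq (.assign (i + 2) (.var i)) (.seq B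
    (.seq (.assign (i + 3) (.const 0)) (.seq (.assign (i + 4) (.var (i + 1))) (.seq F
      (.seq (.loop (.lt (.var (i + 3)) (.var (i + 2)))
          (.seq (pairProg (i + 5) (i + 3) (i + 4)) (.seq (pairProg (i + 4) (i + 1) (i + 5))
            (.seq G (.assign (i + 3) (.add (.var (i + 3)) (.const 1)))))))
        (.assign i (.var (i + 4)))))))))), fun η x hx => ?_⟩
  refine reaches_seq (reaches_assign x (by simp [AExp.eval, hx]) ?_)
  refine reaches_seq ((hA _ x (by simp)).mono fun η₁ ⟨h₁, h₁'⟩ => ?_)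
  have hx₁ : η₁.val i = x := by rw [h₁' i (by omega)]; simp [hx]
  refine reaches_seq (reaches_assign x (by simp [AExp.eval, hx₁]) ?_)
  refine reaches_seq ((hB _ x (by simp)).mono fun η₂ ⟨h₂, h₂'⟩ => ?_)
  have ha₂ : η₂.val (i + 1) = x.unpair.1 := by rw [h₂' (i + 1) (by omega)]; simp [h₁]
  refine reaches_seq (reaches_assign 0 (by simp [AExp.eval]) ?_)
  refine reaches_seq (reaches_assign x.unpair.1 (by simp [AExp.eval, ha₂]) ?_)
  refine reaches_seq ((hF _ x.unpair.1 (by simp)).mono fun η₃ ⟨h₃, h₃'⟩ => ?_)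
  have ha₃ : η₃.val (i + 1) = x.unpair.1 := by rw [h₃' (i + 1) (by omega)]; simp [ha₂]
  have hn₃ : η₃.val (i + 2) = x.unpair.2 := by rw [h₃' (i + 2) (by omega)]; simp [h₂]
  have hk₃ : η₃.val (i + 3) = 0 := by rw [h₃' (i + 3) (by omega)]; simp
  have hj₃ : ∀ j, j < i → η₃.val j = η.val j := by
    intro j hj
    rw [h₃' j (by omega), Input.val_update_of_ne _ (by omega),
      Input.val_update_of_ne _ (by omega), h₂' j (by omega),
      Input.val_update_of_ne _ (by omega), h₁' j (by omega),
      Input.val_update_of_ne _ (by omega)]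
  -- The sequence of intermediate values is made opaque, so that the loop invariant uses only its
  -- recursion equations.
  obtain ⟨r, hr₀, hr₁, hr₂⟩ : ∃ r : ℕ → ℕ, r 0 = f x.unpair.1 ∧
      (∀ k, r (k + 1) = g (Nat.pair x.unpair.1 (Nat.pair k (r k)))) ∧
      r x.unpair.2 = Nat.unpaired (fun z n =>
        n.rec (f z) fun y IH => g (Nat.pair z (Nat.pair y IH))) x :=
    ⟨fun n => n.rec (f x.unpair.1) fun y IH => g (Nat.pair x.unpair.1 (Nat.pair y IH)),
      rfl, fun _ => rfl, rfl⟩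
  refine reaches_seq (reaches_loop (fun m ζ => ∃ k : ℕ, k + m = x.unpair.2 ∧
    ζ.val (i + 1) = x.unpair.1 ∧ ζ.val (i + 2) = x.unpair.2 ∧ ζ.val (i + 3) = k ∧
    ζ.val (i + 4) = r k ∧ ∀ j, j < i → ζ.val j = η.val j) ?_ ?_ (k := x.unpair.2)
    ⟨0, by simp, ha₃, hn₃, by simpa using hk₃, hr₀ ▸ h₃, hj₃⟩)
  · rintro ζ ⟨k, hk, ha, hn, hk', hr, hj⟩
    obtain rfl : k = x.unpair.2 := hk
    refine ⟨by simp [BExp.eval, AExp.eval, hn, hk'], ?_⟩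
    refine reaches_assign (r x.unpair.2) (by simp [AExp.eval, hr]) ⟨?_, fun j hj' => ?_⟩
    · rw [← hr₂]; simp
    · rw [Input.val_update_of_ne _ (by omega), hj j hj']
  · rintro m ζ ⟨k, hk, ha, hn, hk', hr, hj⟩
    refine ⟨?_, ?_⟩
    · have : k < x.unpair.2 := by omega
      simpa [BExp.eval, AExp.eval, hn, hk'] using this
    refine reaches_seq (reaches_pairProg (by simp) (by simp) hk' hr ?_)
    refine reaches_seq (reaches_pairProg (m := x.unpair.1) (n := Nat.pair k (r k))
      (by simp) (by simp) (by simp [ha]) (by simp) ?_)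
    refine reaches_seq ((hG _ (Nat.pair x.unpair.1 (Nat.pair k (r k)))
      (by simp)).mono fun ζ' ⟨h, h'⟩ => ?_)
    have e : ∀ j, j < i + 4 → ζ'.val j = ζ.val j := fun j hj => by
      rw [h' j hj, Input.val_update_of_ne _ (by omega), 
        Input.val_update_of_ne _ (by omega)]
    have hk'' : ζ'.val (i + 3) = k := by rw [e _ (by omega), hk']
    refine reaches_assign (k + 1) (by simp [AExp.eval, hk'']) ⟨k + 1, by omega, ?_, ?_, ?_, ?_, ?_⟩
    · simp [e, ha]
    · simp [e, hn]
    · simp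
    · simp [h, hr₁]
    · intro j hj'
      rw [Input.val_update_of_ne _ (by omega), e j (by omega), hj j hj']

/-- The position `i` is quantified inside the induction because pairing and recursion run their
parts at shifted positions. -/
theorem exists_computesAt {f : ℕ → ℕ} (hf : Nat.Primrec f) : ∀ i, ∃ P, ComputesAt i P f := by
  induction hf with
  | zero =>
    exact fun i => ⟨.assign i (.const 0), fun η n hn =>
      reaches_assign 0 (by simp [AExp.eval]) ⟨by simp, fun j hj => by
        rw [Input.val_update_of_ne _ (by omega)]⟩⟩
  | succ =>
    exact fun i => ⟨.assign i (.add (.var i) (.const 1)), fun η n hn =>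
      reaches_assign (n + 1) (by simp [AExp.eval, hn]) ⟨by simp, fun j hj => by
        rw [Input.val_update_of_ne _ (by omega)]⟩⟩
  | left => exact exists_computesAt_left
  | right => exact exists_computesAt_right
  | pair _ _ hf hg => exact exists_computesAt_pair hf hg
  | comp _ _ hf hg =>
    intro i
    obtain ⟨F, hF⟩ := hf i
    obtain ⟨G, hG⟩ := hg i
    exact ⟨.seq G F, fun η n hn => reaches_seq ((hG η n hn).mono fun η₁ ⟨h₁, h₁'⟩ =>
      (hF η₁ _ h₁).mono fun η₂ ⟨h₂, h₂'⟩ => ⟨h₂, fun j hj => (h₂' j hj).trans (h₁' j hj)⟩)⟩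
  | prec _ _ hf hg => exact exists_computesAt_prec hf hg

end PGCL

/-! ### Normal form of `Π₂⁰` sets. -/

/-- Every `Π₂⁰` set has a primitive recursive matrix. -/
theorem IsPi2.exists_primrec {β : Type} [Primcodable β] {C : Set β} (hC : IsPi2 C) :
    ∃ h : ℕ → ℕ, Nat.Primrec h ∧ ∀ x, x ∈ C ↔
      ∀ y, ∃ z, h (Nat.pair (Encodable.encode x) (Nat.pair y z)) = 0 := by
  obtain ⟨R, ⟨_, hR⟩, hCR⟩ := hC
  obtain ⟨c, hc⟩ := Nat.Partrec.Code.exists_code.1 hR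
  have heval : ∀ x : β × ℕ × ℕ, Nat.Partrec.Code.eval c (Encodable.encode x) =
      Part.some (Encodable.encode (decide (R x))) := by
    intro x
    simp [hc]
  -- The value `true` is encoded by 1; bounded evaluation is primitive recursive even though the
  -- decision procedure need not be.
  have hiff : ∀ x, R x ↔ ∃ k, Nat.Partrec.Code.evaln k c (Encodable.encode x) = some 1 := by
    intro x
    have h : R x ↔ 1 ∈ Nat.Partrec.Code.eval c (Encodable.encode x) := by
      rw [heval, Part.mem_some_iff]
      by_cases hx : R x <;> simp [hx]
    rw [h, Nat.Partrec.Code.evaln_complete]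
    rfl
  -- The witness `z` packs the original witness `y₂` together with an evaluation bound `k`.
  refine ⟨fun n => if Nat.Partrec.Code.evaln n.unpair.2.unpair.2.unpair.2 c
    (Nat.pair n.unpair.1 (Nat.pair n.unpair.2.unpair.1 n.unpair.2.unpair.2.unpair.1)) = some 1
    then 0 else 1, ?_, fun x => ?_⟩
  · have h2 : Primrec fun n : ℕ => n.unpair.2 := Primrec.snd.comp Primrec.unpair
    have h1 : Primrec fun n : ℕ => n.unpair.1 := Primrec.fst.comp Primrec.unpair
    have h22 := h2.comp h2
    have hk := h2.comp h22
    have harg := Primrec₂.natPair.comp h1 (Primrec₂.natPair.comp (h1.comp h2) (h1.comp h22))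
    have he := Nat.Partrec.Code.primrec_evaln.comp ((hk.pair (Primrec.const c)).pair harg)
    have hp := PrimrecPred.decide (Primrec.eq.comp he (Primrec.const (some 1)))
    exact Primrec.nat_iff.1 ((Primrec.cond hp (Primrec.const 0) (Primrec.const 1)).of_eq
      fun n => by simp [Bool.cond_decide])
  · rw [hCR]
    refine forall_congr' fun y => ?_
    constructor
    · rintro ⟨y₂, hy⟩
      obtain ⟨k, hk⟩ := (hiff _).1 hy
      exact ⟨Nat.pair y₂ k, by simpa using hk⟩
    · rintro ⟨z, hz⟩
      refine ⟨z.unpair.1, (hiff _).2 ⟨z.unpair.2, ?_⟩⟩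
      simpa using hz

namespace PGCL

/-! ## Hardness -/

/-- Given a program `H` for `h` on the variable `4`, store `h ⟨v₀, ⟨v₁, v₃⟩⟩` in `v₄`. -/
def testProg (H : Prog) : Prog := .seq (pairProg 5 1 3) (.seq (pairProg 4 0 5) H)

/-- While the test fails, try the next value of `v₃`. -/
def searchLoop (H : Prog) : Prog :=
  .loop (.not (.eq (.var 4) (.const 0)))
    (.seq (.assign 3 (.add (.var 3) (.const 1))) (testProg H))

/-- Search for a value of `v₃` for which the test succeeds. -/
def searchProg (H : Prog) : Prog :=
  .seq (.assign 3 (.const 0)) (.seq (testProg H) (searchLoop H))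

/-- Probability one half. -/
def half : Prob := ⟨1 / 2, by norm_num⟩

/-- Search, then stop or go on to the next value of `v₁` with equal probabilities. -/
def roundProg (H : Prog) : Prog :=
  .seq (searchProg H) (.choice half (.assign 2 (.const 1)) (.assign 1 (.add (.var 1) (.const 1))))

/-- Search successively for each value of `v₁`, stopping with probability one half after every
success. -/
def hardProg (H : Prog) : Prog := .loop (.eq (.var 2) (.const 0)) (roundProg H)

section
variable {H : Prog} {h : ℕ → ℕ} {X y : ℕ}

/-- Variables 0 to 3 hold the instance, the current `y`, the stop flag and the candidate `z`; they
survive because `H` works at position 4. -/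
theorem reaches_testProg (hH : ComputesAt 4 H h) {η : Input} {z : ℕ} (h0 : η.val 0 = X)
    (h1 : η.val 1 = y) (h3 : η.val 3 = z) :
    Reaches (testProg H) η fun η' => η'.val 4 = h (Nat.pair X (Nat.pair y z)) ∧
      ∀ j : ℕ, j < 4 → η'.val j = η.val j := by
  refine reaches_seq (reaches_pairProg (by decide) (by decide) h1 h3 ?_)
  refine reaches_seq (reaches_pairProg (m := X) (n := Nat.pair y z) (by decide) (by decide)
    (by simp [h0]) (by simp) ?_)
  refine (hH _ _ (by simp)).mono fun η' ⟨h₁, h₁'⟩ => ⟨h₁, fun j hj => ?_⟩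
  rw [h₁' j hj, Input.val_update_of_ne _ (by omega), Input.val_update_of_ne _ (by omega)]

/-- The states in which the search loop for `X` and `y` is entered. -/
def Searching (h : ℕ → ℕ) (X y z : ℕ) (η : Input) : Prop :=
  η.val 0 = X ∧ η.val 1 = y ∧ η.val 2 = 0 ∧ η.val 3 = z ∧
    η.val 4 = h (Nat.pair X (Nat.pair y z))

theorem reaches_searching (hH : ComputesAt 4 H h) {η : Input} {z : ℕ} (h0 : η.val 0 = X)
    (h1 : η.val 1 = y) (h2 : η.val 2 = 0) (h3 : η.val 3 = z) :
    Reaches (testProg H) η (Searching h X y z) :=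
  (reaches_testProg hH h0 h1 h3).mono fun η' ⟨h4, hj⟩ =>
    ⟨by rw [hj 0 (by omega), h0], by rw [hj 1 (by omega), h1], by rw [hj 2 (by omega), h2],
      by rw [hj 3 (by omega), h3], h4⟩

theorem reaches_searchBody (hH : ComputesAt 4 H h) {η : Input} {z : ℕ}
    (hη : Searching h X y z η) :
    Reaches (.seq (.assign 3 (.add (.var 3) (.const 1))) (testProg H)) η
      (Searching h X y (z + 1)) := by
  obtain ⟨h0, h1, h2, h3, -⟩ := hη
  refine reaches_seq (reaches_assign (z + 1) (by simp [AExp.eval, h3]) ?_)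
  exact reaches_searching hH (by simp [h0]) (by simp [h1]) (by simp [h2]) (by simp)

theorem reaches_searchInit (hH : ComputesAt 4 H h) {η : Input} (h0 : η.val 0 = X)
    (h1 : η.val 1 = y) (h2 : η.val 2 = 0) :
    Reaches (.assign 3 (.const 0)) η fun η' => Reaches (testProg H) η' (Searching h X y 0) := by
  refine reaches_assign 0 (by simp [AExp.eval]) ?_
  exact reaches_searching hH (by simp [h0]) (by simp [h1]) (by simp [h2]) (by simp)

theorem Searching.eval_test {η : Input} {z : ℕ} (hη : Searching h X y z η) :
    BExp.eval η.val (.not (.eq (.var 4) (.const 0))) =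
      decide (h (Nat.pair X (Nat.pair y z)) ≠ 0) := by
  simp [BExp.eval, AExp.eval, hη.2.2.2.2]

theorem reaches_searchProg (hH : ComputesAt 4 H h) {η : Input} (h0 : η.val 0 = X)
    (h1 : η.val 1 = y) (h2 : η.val 2 = 0) (hz : ∃ z, h (Nat.pair X (Nat.pair y z)) = 0) :
    Reaches (searchProg H) η fun η' => η'.val 0 = X ∧ η'.val 1 = y ∧ η'.val 2 = 0 := by
  refine reaches_seq ((reaches_searchInit hH h0 h1 h2).mono fun η₁ h₁ =>
    reaches_seq (h₁.mono fun η₂ h₂ => ?_))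
  -- The number of remaining iterations is the distance from `z` to the least witness.
  refine reaches_loop (fun k ζ => ∃ z, z + k = Nat.find hz ∧ Searching h X y z ζ) ?_ ?_
    (k := Nat.find hz) ⟨0, by simp, h₂⟩
  · rintro ζ ⟨z, rfl, hζ⟩
    refine ⟨?_, hζ.1, hζ.2.1, hζ.2.2.1⟩
    rw [hζ.eval_test]
    simpa using Nat.find_spec hz
  · rintro k ζ ⟨z, hzk, hζ⟩
    refine ⟨?_, (reaches_searchBody hH hζ).mono fun ζ' hζ' => ⟨z + 1, by omega, hζ'⟩⟩
    rw [hζ.eval_test]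
    simpa using Nat.find_min hz (m := z) (by omega)

/-- Without a witness the loop-entry states, over all `z`, are closed under one full iteration,
which is a deterministic run of positive length. -/
theorem haltTotal_searchLoop (hH : ComputesAt 4 H h)
    (hz : ∀ z, h (Nat.pair X (Nat.pair y z)) ≠ 0) {η : Input} {z : ℕ} (hη : Searching h X y z η)
    (K : List Prog) : haltTotal ((some (searchLoop H), K), η) = 0 := by
  refine haltTotal_eq_zero
    {c | ∃ ζ z, Searching h X y z ζ ∧ c = ((some (searchLoop H), K), ζ)} ?_ ⟨η, z, hη, rfl⟩
  rintro c ⟨ζ, z, hζ, rfl⟩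
  obtain ⟨ζ', hex, hζ'⟩ := reaches_searchBody hH hζ
  obtain ⟨n, hn⟩ := hex.runs_seq (Q := searchLoop H)
  refine ⟨1 + n, _, ⟨ζ', z + 1, hζ', rfl⟩, ?_⟩
  exact (Runs.single (succs_loop_of_true (by rw [hζ.eval_test]; simpa using hz z))).trans (hn K)

/-- The states in which the search for `y` is about to start. -/
def AtRound (X y : ℕ) (η : Input) : Prop := η.val 0 = X ∧ η.val 1 = y ∧ η.val 2 = 0

theorem haltTotal_hardProg_eq {η : Input} (hη : η.val 2 = 0) :
    haltTotal (initConfig (hardProg H) η) =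
      haltTotal ((some (searchProg H),
        [.choice half (.assign 2 (.const 1)) (.assign 1 (.add (.var 1) (.const 1))),
          hardProg H]), η) := by
  have h1 : succs (initConfig (hardProg H) η) =
      [(1, (some (.seq (roundProg H) (hardProg H)), []), η)] :=
    succs_loop_of_true (by simp [BExp.eval, AExp.eval, hη])
  rw [haltTotal_of_succs_singleton h1]
  have h2 : succs ((some (.seq (roundProg H) (hardProg H)), []), η) =
      succs ((some (searchProg H),
        [.choice half (.assign 2 (.const 1)) (.assign 1 (.add (.var 1) (.const 1))),
          hardProg H]), η) := by
    rw [succs_seq, roundProg, succs_seq]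
  -- Two configurations with the same successors have the same total once neither is halted at time
  -- 0.
  have hne : ∀ (P : Prog) K, haltProb 0 ((some P, K), η) = 0 := fun P K => by
    simp [haltProb, halted]
  rw [haltTotal_eq_add, haltTotal_eq_add, hne, hne]
  simp only [haltProb, h2]

theorem haltTotal_hardProg_of_not_exists (hH : ComputesAt 4 H h)
    (hz : ∀ z, h (Nat.pair X (Nat.pair y z)) ≠ 0) {η : Input} (hη : AtRound X y η) :
    haltTotal (initConfig (hardProg H) η) = 0 := by
  rw [haltTotal_hardProg_eq hη.2.2]
  obtain ⟨η₁, hex₁, η₂, hex₂, hη₂⟩ := reaches_searchInit hH hη.1 hη.2.1 hη.2.2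
  obtain ⟨m, hm⟩ := hex₁.runs_seq (Q := .seq (testProg H) (searchLoop H))
  obtain ⟨n, hn⟩ := hex₂.runs_seq (Q := searchLoop H)
  rw [searchProg, (hm _).haltTotal_eq, (hn _).haltTotal_eq]
  exact haltTotal_searchLoop hH hz hη₂ _

theorem haltTotal_halted (η : Input) : haltTotal ((none, []), η) = 1 := by
  rw [haltTotal_eq_add]
  simp [haltProb, halted, succs]

/-- After the successful search, the left branch raises the flag and the outer loop exits with
probability 1; the right branch starts the round for `y + 1`. -/
theorem haltTotal_hardProg_of_exists (hH : ComputesAt 4 H h)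
    (hz : ∃ z, h (Nat.pair X (Nat.pair y z)) = 0) {η : Input} (hη : AtRound X y η) :
    ∃ ζ, AtRound X (y + 1) ζ ∧ haltTotal (initConfig (hardProg H) η) =
      2⁻¹ + 2⁻¹ * haltTotal (initConfig (hardProg H) ζ) := by
  rw [haltTotal_hardProg_eq hη.2.2]
  obtain ⟨η₁, ⟨n, hn⟩, h0, h1, h2⟩ := reaches_searchProg hH hη.1 hη.2.1 hη.2.2 hz
  rw [(hn _).haltTotal_eq, haltTotal_of_succs_singleton (d := ((some _, [hardProg H]), η₁)) rfl,
    haltTotal_of_succs_pair (d := ((some _, [hardProg H]), η₁))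
      (d' := ((some _, [hardProg H]), η₁)) rfl]
  obtain ⟨η₂, ⟨k, hk⟩, hη₂⟩ : Reaches (.assign 2 (.const 1)) η₁ fun η' => η'.val 2 = 1 :=
    reaches_assign 1 (by simp [AExp.eval]) (by simp)
  obtain ⟨ζ, ⟨l, hl⟩, hζ⟩ : Reaches (.assign 1 (.add (.var 1) (.const 1))) η₁
      (AtRound X (y + 1)) :=
    reaches_assign (y + 1) (by simp [AExp.eval, h1]) ⟨by simp [h0], by simp, by simp [h2]⟩
  have hExit : Exec (hardProg H) η₂ η₂ :=
    exec_loop_of_false (by simp [BExp.eval, AExp.eval, hη₂])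
  obtain ⟨m, hm⟩ := hExit
  refine ⟨ζ, hζ, ?_⟩
  rw [(hk _).haltTotal_eq, haltTotal_of_succs_singleton (d := ((some (hardProg H), []), η₂)) rfl,
    (hm _).haltTotal_eq, haltTotal_halted, (hl _).haltTotal_eq,
    haltTotal_of_succs_singleton (d := ((some (hardProg H), []), ζ)) rfl]
  have hp : ((half.1 : ℝ≥0) : ℝ≥0∞) = 2⁻¹ := by
    have : (half.1 : ℝ≥0) = 2⁻¹ := by simp [half]
    rw [this]; simp
  have hq : (((1 - half.1 : ℚ≥0) : ℝ≥0) : ℝ≥0∞) = 2⁻¹ := by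
    have : (1 - half.1 : ℚ≥0) = half.1 :=
      tsub_eq_of_eq_add (by simp only [half]; norm_num)
    rw [this, hp]
  rw [hp, hq, mul_one]
  rfl

theorem haltTotal_hardProg_eq_one (hH : ComputesAt 4 H h)
    (hz : ∀ y, ∃ z, h (Nat.pair X (Nat.pair y z)) = 0) {η : Input} (hη : AtRound X y η) :
    haltTotal (initConfig (hardProg H) η) = 1 := by
  -- Each use of the one-round identity halves the possible deficit, starting from the trivial bound
  -- 1.
  have key : ∀ n y η, AtRound X y η →
      1 ≤ haltTotal (initConfig (hardProg H) η) + (2⁻¹ : ℝ≥0∞) ^ n := by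
    intro n
    induction n with
    | zero => intro y η _; simp
    | succ n ih =>
      intro y η hη
      obtain ⟨ζ, hζ, e⟩ := haltTotal_hardProg_of_exists hH (hz y) hη
      calc (1 : ℝ≥0∞) = 2⁻¹ + 2⁻¹ * 1 := by rw [mul_one, ENNReal.inv_two_add_inv_two]
        _ ≤ 2⁻¹ + 2⁻¹ * (haltTotal (initConfig (hardProg H) ζ) + 2⁻¹ ^ n) := by
          gcongr; exact ih _ ζ hζ
        _ = _ := by rw [e, pow_succ]; ring
  refine le_antisymm (haltTotal_le_one _) (ENNReal.le_of_forall_pos_le_add fun ε hε _ => ?_)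
  obtain ⟨n, hn⟩ := ENNReal.exists_inv_two_pow_lt (a := ε) (by exact_mod_cast hε.ne')
  exact (key n y η hη).trans (by gcongr)

/-- Strictness at `y₀`, where the total is 0, passes back to every earlier round, since `t < 1`
gives `2⁻¹ + 2⁻¹ * t < 1`. An earlier `y` without a witness already gives 0. -/
theorem haltTotal_hardProg_lt_one (hH : ComputesAt 4 H h) {y₀ : ℕ}
    (hz : ∀ z, h (Nat.pair X (Nat.pair y₀ z)) ≠ 0) {η : Input} (hη : AtRound X y η)
    (hy : y ≤ y₀) : haltTotal (initConfig (hardProg H) η) < 1 := by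
  obtain ⟨n, rfl⟩ := Nat.exists_eq_add_of_le hy
  induction n generalizing y η with
  | zero => rw [haltTotal_hardProg_of_not_exists hH hz hη]; exact one_pos
  | succ n ih =>
    by_cases hzy : ∃ z, h (Nat.pair X (Nat.pair y z)) = 0
    · obtain ⟨ζ, hζ, e⟩ := haltTotal_hardProg_of_exists hH hzy hη
      have e' : y + (n + 1) = y + 1 + n := by ring
      rw [e'] at hz hy
      have hlt := ih hζ hz (by omega)
      calc _ = 2⁻¹ + 2⁻¹ * haltTotal (initConfig (hardProg H) ζ) := e
        _ < 2⁻¹ + 2⁻¹ * 1 := by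
          refine ENNReal.add_lt_add_left (by simp) ?_
          exact ENNReal.mul_lt_mul_right (by simp) (by simp) hlt
        _ = 1 := by rw [mul_one, ENNReal.inv_two_add_inv_two]
    · rw [haltTotal_hardProg_of_not_exists hH (by simpa using hzy) hη]; exact one_pos

end

/-- The input with the value `n` of `v₀` and all other variables `0`. -/
def natInput (n : ℕ) : Input := inputOfList [Nat.pair n 0]

/-- Codes of rationals store the denominator minus one, so `Nat.pair n 0` denotes `n / 1`. -/
theorem atRound_natInput (n : ℕ) : AtRound n 0 (natInput n) := by
  simp [AtRound, natInput, inputOfList, ratOfCode]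

theorem AST_hard (β : Type) [Primcodable β] (C : Set β) (hC : IsPi2 C) : (· ∈ C) ≤₀ (· ∈ AST) := by
  obtain ⟨h, hprim, hiff⟩ := hC.exists_primrec
  obtain ⟨H, hH⟩ := exists_computesAt hprim 4
  refine ⟨fun x => (hardProg H, natInput (Encodable.encode x)), ?_, fun x => ?_⟩
  · exact ((Primrec.const (hardProg H)).pair (primrec_inputOfList.comp (primrec_singleton.comp
      (Primrec₂.natPair.comp Primrec.encode (Primrec.const 0))))).to_comp
  · change x ∈ C ↔ prTerm _ _ = 1
    rw [hiff, prTerm_eq_haltTotal]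
    constructor
    · intro hx
      exact haltTotal_hardProg_eq_one hH hx (atRound_natInput _)
    · intro h1
      by_contra hx
      push Not at hx
      obtain ⟨y₀, hy₀⟩ := hx
      exact (haltTotal_hardProg_lt_one hH hy₀ (atRound_natInput _) (Nat.zero_le _)).ne h1

end PGCL

theorem mainTheorem1 : IsPi2Complete PGCL.AST := by
  exact ⟨PGCL.isPi2_AST, PGCL.AST_hard⟩
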